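/- Let $N\ge 1$, let $\Omega\subset\mathbb R^N$ be a (bounded) Lipschitz domain with boundary $\Gamma=\partial\Omega$, and let $T>0$. Write $(\cdot,\cdot)$ and $(\cdot,\cdot)_\Gamma$ for the inner products of $L^2(\Omega)$ (and $L^2(\Omega;\mathbb R^N)$) and of $L^2(\Gamma)$, $\langle\cdot,\cdot\rangle$ for the duality between $(H^1(\Omega))^*$ and $H^1(\Omega)$, and $(K\ast v)(t)=\int_0^t K(t-s)v(s)\,ds$. Let $u_0\in L^2(\Omega)$, $g:[0,T]\to L^2(\Gamma)$, $h\in C([0,T],L^2(\Omega))$ with $$|(h(t),1)|\ge\omega>0\qquad\text{for all } t\in[0,T],$$ let $m\in C([0,T])$, and let $f=f(x,t,r,p)$ be a real function that is Lipschitz continuous in all its variables on $\Omega\times[0,T]\times\mathbb R\times\mathbb R^N$; write $f(u,\nabla u)(x,t)=f(x,t,u(x,t),\nabla u(x,t))$. Then there is at most one pair $\langle u,K\rangle\in L^2((0,T),H^1(\Omega))\times L^2(0,T)$ with $\partial_t u\in L^2((0,T),(H^1(\Omega))^*)$ such that $u(0)=u_0$ and, for almost every $t\in(0,T)$, $$\langle\partial_t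 u,\phi\rangle+(\nabla u,\nabla\phi)+(g,\phi)_\Gamma+K(h,\phi)+(K\ast u,\phi)=(f(u,\nabla u),\phi)\quad\text{for all }\phi\in H^1(\Omega),\tag{P}$$ $$m'+(g,1)_\Gamma+K(h,1)+K\ast m=(f(u,\nabla u),1).\tag{MP}$$ Here $\partial_t u$ is the distributional time derivative (with $H^1(\Omega)\subset L^2(\Omega)\subset(H^1(\Omega))^*$), the initial condition refers to the representative of $u$ in $C([0,T],L^2(\Omega))$, $\phi$ in $(g,\phi)_\Gamma$ is the boundary trace of $\phi$, and $m'$ is the weak derivative of $m$ on $(0,T)$, whose existence as a locally integrable function is part of (MP). -/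

import Mathlib

noncomputable section

namespace KernelReconstruction

open MeasureTheory Set Filter Topology
open scoped ContDiff ENNReal InnerProductSpace

/-- The Euclidean space `ℝ^N`. -/
abbrev Space (N : ℕ) : Type := EuclideanSpace ℝ (Fin N)

/-- A (bounded) Lipschitz domain of `ℝ^N`: a bounded, open, connected set which, near each of its
boundary points, is the strict epigraph, in the direction of some unit vector `ν`, of a Lipschitz
function `γ` defined on the hyperplane orthogonal to `ν`. -/
structure IsLipschitzDomain {N : ℕ} (Ω : Set (Space N)) : Prop where
  isOpen : IsOpen Ω
  isConnected : IsConnected Ω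
  isBounded : Bornology.IsBounded Ω
  boundary : ∀ x ∈ frontier Ω, ∃ ν : Space N, ‖ν‖ = 1 ∧
    ∃ (L : NNReal) (γ : (ℝ ∙ ν)ᗮ → ℝ), LipschitzWith L γ ∧
      ∃ r : ℝ, 0 < r ∧ ∀ y ∈ Metric.ball x r,
        (y ∈ Ω ↔ γ ((ℝ ∙ ν)ᗮ.orthogonalProjectionOnto y) < ⟪ν, y⟫_ℝ)

/-- `φ ∈ C_c^∞(U)`. -/
structure IsTestFunction {E : Type*} [NormedAddCommGroup E] [NormedSpace ℝ E]
    (U : Set E) (φ : E → ℝ) : Prop where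
  contDiff : ContDiff ℝ ∞ φ
  hasCompactSupport : HasCompactSupport φ
  tsupport_subset : tsupport φ ⊆ U

/-- The space `L²(Ω)`. -/
abbrev L2 {N : ℕ} (Ω : Set (Space N)) : Type :=
  Lp ℝ 2 (volume.restrict Ω : Measure (Space N))

/-- The space `L²(Ω; ℝ^N)`. -/
abbrev L2Vec {N : ℕ} (Ω : Set (Space N)) : Type :=
  Lp (Space N) 2 (volume.restrict Ω : Measure (Space N))

/-- `G = ∇v` weakly in `Ω`. -/
def IsWeakGradient {N : ℕ} (Ω : Set (Space N)) (v : L2 Ω) (G : L2Vec Ω) : Prop :=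
  ∀ φ : Space N → ℝ, IsTestFunction Ω φ → ∀ i : Fin N,
    ∫ x in Ω, v x * fderiv ℝ φ x (EuclideanSpace.single i 1) = - ∫ x in Ω, G x i * φ x

lemma IsTestFunction.memLp {N : ℕ} {Ω : Set (Space N)} {φ : Space N → ℝ}
    (hφ : IsTestFunction Ω φ) : MemLp φ 2 (volume.restrict Ω) :=
  (hφ.contDiff.continuous.memLp_of_hasCompactSupport hφ.hasCompactSupport).restrict Ω

lemma IsTestFunction.memLp_fderiv {N : ℕ} {Ω : Set (Space N)} {φ : Space N → ℝ}
    (hφ : IsTestFunction Ω φ) (v : Space N) :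
    MemLp (fun x => fderiv ℝ φ x v) 2 (volume.restrict Ω) := by
  have hc : Continuous (fun x => fderiv ℝ φ x v) :=
    (hφ.contDiff.continuous_fderiv (by simp)).clm_apply continuous_const
  exact (hc.memLp_of_hasCompactSupport (hφ.hasCompactSupport.fderiv_apply ℝ v)).restrict Ω

lemma L2Vec.memLp_apply {N : ℕ} {Ω : Set (Space N)} (G : L2Vec Ω) (i : Fin N) :
    MemLp (fun x => G x i) 2 (volume.restrict Ω) :=
  (EuclideanSpace.proj i : Space N →L[ℝ] ℝ).comp_memLp' (Lp.memLp G)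

lemma IsWeakGradient.zero {N : ℕ} (Ω : Set (Space N)) :
    IsWeakGradient Ω (0 : L2 Ω) (0 : L2Vec Ω) := by
  intro φ _ i
  have h1 : ∫ x in Ω, (0 : L2 Ω) x * fderiv ℝ φ x (EuclideanSpace.single i 1) = 0 := by
    apply integral_eq_zero_of_ae
    filter_upwards [Lp.coeFn_zero ℝ 2 (volume.restrict Ω : Measure (Space N))] with x hx
    rw [hx]
    simp
  have h2 : ∫ x in Ω, (0 : L2Vec Ω) x i * φ x = 0 := by
    apply integral_eq_zero_of_ae
    filter_upwards [Lp.coeFn_zero (Space N) 2 (volume.restrict Ω : Measure (Space N))] with x hx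
    rw [hx]
    simp
  rw [h1, h2, neg_zero]

lemma IsWeakGradient.add {N : ℕ} {Ω : Set (Space N)} {v w : L2 Ω} {G H : L2Vec Ω}
    (hv : IsWeakGradient Ω v G) (hw : IsWeakGradient Ω w H) :
    IsWeakGradient Ω (v + w) (G + H) := by
  intro φ hφ i
  have hd := hφ.memLp_fderiv (EuclideanSpace.single i 1)
  have h1 : ∫ x in Ω, (v + w) x * fderiv ℝ φ x (EuclideanSpace.single i 1)
      = ∫ x in Ω, (v x * fderiv ℝ φ x (EuclideanSpace.single i 1)
        + w x * fderiv ℝ φ x (EuclideanSpace.single i 1)) := by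
    apply integral_congr_ae
    filter_upwards [Lp.coeFn_add v w] with x hx
    simp only [hx, Pi.add_apply, add_mul]
  have h2 : ∫ x in Ω, (G + H) x i * φ x = ∫ x in Ω, (G x i * φ x + H x i * φ x) := by
    apply integral_congr_ae
    filter_upwards [Lp.coeFn_add G H] with x hx
    simp only [hx, Pi.add_apply, PiLp.add_apply, add_mul]
  have h3 := integral_add ((Lp.memLp v).integrable_mul hd) ((Lp.memLp w).integrable_mul hd)
  have h4 := integral_add ((L2Vec.memLp_apply G i).integrable_mul hφ.memLp)
    ((L2Vec.memLp_apply H i).integrable_mul hφ.memLp)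
  simp only [Pi.mul_apply] at h3 h4
  rw [h1, h2, h3, h4, hv φ hφ i, hw φ hφ i, neg_add]

lemma IsWeakGradient.smul {N : ℕ} {Ω : Set (Space N)} (c : ℝ) {v : L2 Ω} {G : L2Vec Ω}
    (hv : IsWeakGradient Ω v G) : IsWeakGradient Ω (c • v) (c • G) := by
  intro φ hφ i
  have h1 : ∫ x in Ω, (c • v) x * fderiv ℝ φ x (EuclideanSpace.single i 1)
      = ∫ x in Ω, c * (v x * fderiv ℝ φ x (EuclideanSpace.single i 1)) := by
    apply integral_congr_ae
    filter_upwards [Lp.coeFn_smul c v] with x hx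
    simp only [hx, Pi.smul_apply, smul_eq_mul, mul_assoc]
  have h2 : ∫ x in Ω, (c • G) x i * φ x = ∫ x in Ω, c * (G x i * φ x) := by
    apply integral_congr_ae
    filter_upwards [Lp.coeFn_smul c G] with x hx
    simp only [hx, Pi.smul_apply, PiLp.smul_apply, smul_eq_mul, mul_assoc]
  rw [h1, h2, integral_const_mul, integral_const_mul, hv φ hφ i, mul_neg]

/-- The Sobolev space `H¹(Ω)`, as the space of pairs `(v, ∇v) ∈ L²(Ω) × L²(Ω; ℝ^N)`; the norm
inherited from the product is `‖v‖²_{H¹} = ‖v‖² + ‖∇v‖²`. -/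
def H1 {N : ℕ} (Ω : Set (Space N)) : Submodule ℝ (WithLp 2 (L2 Ω × L2Vec Ω)) where
  carrier := {p | IsWeakGradient Ω p.fst p.snd}
  add_mem' := fun ha hb => ha.add hb
  zero_mem' := IsWeakGradient.zero Ω
  smul_mem' := fun c _ h => h.smul c

/-- The underlying element of `L²(Ω)` of an element of `H¹(Ω)`. -/
def toL2 {N : ℕ} {Ω : Set (Space N)} (v : H1 Ω) : L2 Ω :=
  (v : WithLp 2 (L2 Ω × L2Vec Ω)).fst

/-- The weak gradient of an element of `H¹(Ω)`. -/
def weakGrad {N : ℕ} {Ω : Set (Space N)} (v : H1 Ω) : L2Vec Ω :=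
  (v : WithLp 2 (L2 Ω × L2Vec Ω)).snd

/-- The surface measure on `Γ = ∂Ω`. -/
def surfaceMeasure {N : ℕ} (Ω : Set (Space N)) : Measure (Space N) :=
  (Measure.euclideanHausdorffMeasure (N - 1)).restrict (frontier Ω)

/-- The space `L²(Γ)`. -/
abbrev L2Bdry {N : ℕ} (Ω : Set (Space N)) : Type := Lp ℝ 2 (surfaceMeasure Ω)

/-- `τ` is the boundary trace of `v ∈ H¹(Ω)`: there are smooth functions on `ℝ^N` whose
restrictions to `Ω` converge to `v` in `H¹(Ω)` and whose restrictions to `Γ` converge to `τ` in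
`L²(Γ)`. -/
def IsTrace {N : ℕ} {Ω : Set (Space N)} (v : H1 Ω) (τ : L2Bdry Ω) : Prop :=
  ∃ w : ℕ → Space N → ℝ, (∀ n, ContDiff ℝ ∞ (w n)) ∧
    Tendsto (fun n => eLpNorm (fun x => w n x - toL2 v x) 2 (volume.restrict Ω)) atTop (𝓝 0) ∧
    Tendsto (fun n => eLpNorm (fun x => gradient (w n) x - weakGrad v x) 2 (volume.restrict Ω))
      atTop (𝓝 0) ∧
    Tendsto (fun n => eLpNorm (fun x => w n x - τ x) 2 (surfaceMeasure Ω)) atTop (𝓝 0)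

/-- The boundary trace of `v ∈ H¹(Ω)`. On a Lipschitz domain every `v` has exactly one trace (trace
theorem), so this is the usual trace operator. -/
def trace {N : ℕ} {Ω : Set (Space N)} (v : H1 Ω) : L2Bdry Ω :=
  Classical.epsilon (fun τ => IsTrace v τ)

/-- Lebesgue measure on the open time interval `(0,T)`. -/
abbrev timeMeasure (T : ℝ) : Measure ℝ := volume.restrict (Ioo 0 T)

/-- The space `L²((0,T), X)`. -/
abbrev L2Time (T : ℝ) (X : Type*) [NormedAddCommGroup X] : Type _ := Lp X 2 (timeMeasure T)

/-- `u' = ∂ₜu` in the sense of distributions on `(0,T)` with values in `(H¹(Ω))*`, where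
`H¹(Ω) ⊆ L²(Ω) ⊆ (H¹(Ω))*` through the inner product of `L²(Ω)`. -/
def IsWeakTimeDeriv {N : ℕ} {Ω : Set (Space N)} {T : ℝ}
    (u : L2Time T (H1 Ω)) (u' : L2Time T (StrongDual ℝ (H1 Ω))) : Prop :=
  ∀ φ : H1 Ω, ∀ ψ : ℝ → ℝ, IsTestFunction (Ioo 0 T) ψ →
    ∫ t in Ioo 0 T, deriv ψ t * ⟪toL2 (u t), toL2 φ⟫_ℝ = - ∫ t in Ioo 0 T, ψ t * u' t φ

/-- `m'` is the (locally integrable) weak derivative of `m` on `(0,T)`. -/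
def IsWeakDeriv (T : ℝ) (m m' : ℝ → ℝ) : Prop :=
  LocallyIntegrableOn m' (Ioo 0 T) ∧
    ∀ ψ : ℝ → ℝ, IsTestFunction (Ioo 0 T) ψ →
      ∫ t in Ioo 0 T, m t * deriv ψ t = - ∫ t in Ioo 0 T, m' t * ψ t

/-- `u(0) = u₀`, for the representative of `u` in `C([0,T], L²(Ω))`. -/
def HasInitialValue {N : ℕ} {Ω : Set (Space N)} {T : ℝ} (u : L2Time T (H1 Ω)) (u₀ : L2 Ω) : Prop :=
  ∃ w : ℝ → L2 Ω, ContinuousOn w (Icc 0 T) ∧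
    (∀ᵐ t ∂(timeMeasure T), w t = toL2 (u t)) ∧ w 0 = u₀

/-- The convolution in time `(K ∗ v)(t) = ∫₀ᵗ K(t - s) v(s) ds`. -/
def timeConv {X : Type*} [NormedAddCommGroup X] [NormedSpace ℝ X] (K : ℝ → ℝ) (v : ℝ → X)
    (t : ℝ) : X :=
  ∫ s in (0 : ℝ)..t, K (t - s) • v s

/-- The data of the problem: the initial value `u₀`, the flux `g`, the source factor `h`, the
measurement `m` and the nonlinearity `f = f(x, t, u, ∇u)`. -/
structure ProblemData {N : ℕ} (Ω : Set (Space N)) where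
  u₀ : L2 Ω
  g : ℝ → L2Bdry Ω
  h : ℝ → L2 Ω
  m : ℝ → ℝ
  f : Space N → ℝ → ℝ → Space N → ℝ

/-- The equation, at time `t`, of the variational formulation:
`⟨∂ₜu, φ⟩ + (∇u, ∇φ) + (g, φ)_Γ + K (h, φ) + (K ∗ u, φ) = (f(u, ∇u), φ)` for all `φ ∈ H¹(Ω)`. -/
def SolvesP {N : ℕ} {Ω : Set (Space N)} {T : ℝ} (D : ProblemData Ω) (u : L2Time T (H1 Ω))
    (u' : L2Time T (StrongDual ℝ (H1 Ω))) (K : L2Time T ℝ) (t : ℝ) : Prop :=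
  ∀ φ : H1 Ω,
    u' t φ + ⟪weakGrad (u t), weakGrad φ⟫_ℝ + ⟪D.g t, trace φ⟫_ℝ + K t * ⟪D.h t, toL2 φ⟫_ℝ
        + ⟪timeConv K (fun s => toL2 (u s)) t, toL2 φ⟫_ℝ
      = ∫ x in Ω, D.f x t (toL2 (u t) x) (weakGrad (u t) x) * toL2 φ x

/-- The measured equation at time `t`:
`m' + (g, 1)_Γ + K (h, 1) + K ∗ m = (f(u, ∇u), 1)`. -/
def SolvesMP {N : ℕ} {Ω : Set (Space N)} {T : ℝ} (D : ProblemData Ω) (m' : ℝ → ℝ)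
    (u : L2Time T (H1 Ω)) (K : L2Time T ℝ) (t : ℝ) : Prop :=
  m' t + (∫ x, D.g t x ∂(surfaceMeasure Ω)) + K t * (∫ x in Ω, D.h t x) + timeConv K D.m t
    = ∫ x in Ω, D.f x t (toL2 (u t) x) (weakGrad (u t) x)

/-- `⟨u, K⟩ ∈ L²((0,T), H¹(Ω)) × L²(0,T)`, with `∂ₜu ∈ L²((0,T), (H¹(Ω))*)`, is a solution of the
variational problem on `(0,T)`. -/
def IsSolution {N : ℕ} {Ω : Set (Space N)} {T : ℝ} (D : ProblemData Ω) (u : L2Time T (H1 Ω))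
    (K : L2Time T ℝ) : Prop :=
  HasInitialValue u D.u₀ ∧
  (∃ u' : L2Time T (StrongDual ℝ (H1 Ω)),
    IsWeakTimeDeriv u u' ∧ ∀ᵐ t ∂(timeMeasure T), SolvesP D u u' K t) ∧
  ∃ m' : ℝ → ℝ, IsWeakDeriv T D.m m' ∧ ∀ᵐ t ∂(timeMeasure T), SolvesMP D m' u K t

/-- `f` is Lipschitz continuous in all its variables on `Ω × [0,T] × ℝ × ℝ^N`. -/
def IsLipschitzInAllVariables {N : ℕ} (Ω : Set (Space N)) (T : ℝ)
    (f : Space N → ℝ → ℝ → Space N → ℝ) : Prop :=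
  ∃ L : ℝ, ∀ x ∈ Ω, ∀ y ∈ Ω, ∀ t ∈ Icc 0 T, ∀ s ∈ Icc 0 T, ∀ (a b : ℝ) (p q : Space N),
    |f x t a p - f y s b q| ≤ L * (‖x - y‖ + |t - s| + |a - b| + ‖p - q‖)

end KernelReconstruction

end

noncomputable section

namespace KernelReconstruction

open MeasureTheory Set Filter Topology
open scoped ContDiff ENNReal InnerProductSpace

/-! Let `u`, `k` be the differences of two solutions and put `α = ‖u(t)‖`, `β = ‖∇u(t)‖`.
Subtracting the measured equations removes the flux and, as weak derivatives are unique, also `m'`.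
Since `|(h,1)|` is bounded below, `|k(t)|` is at most a constant times `‖k‖_{L²(0,t)} + α + β`
(`SolvesMP.mul_abs_sub_le`). Subtracting the variational equations and testing with `u` bounds
`⟨∂ₜu, u⟩` by `-β²` plus mixed terms, each with a factor `α` (`SolvesP.apply_sub_le`). The memory
term is split as `k ∗ u₁ + K₂ ∗ u`, and Cauchy-Schwarz in time bounds it by norms over `(0,t)` only.

The bound on `k` contains `β` with an arbitrarily large constant, but `k` enters the energy
inequality multiplied by `α`. Young's inequality therefore moves that constant onto `α²`, and `-β²`
absorbs the rest, even leaving a small multiple of `k²` on the left (`exists_absorption_constants`).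
Integrating in time closes a Grönwall argument for `‖u(t)‖² + ‖k‖²_{L²(0,t)}` on all of `(0,T)` at
once (`ae_eq_zero_of_energy_inequality`).

The link between `⟨∂ₜu, u⟩` and `‖u‖²` is the energy identity `norm_sq_eq_of_weakDeriv`, proved
without mollification. One writes `‖w(t+δ)‖² - ‖w(t)‖² = (w(t+δ) - w(t), w(t+δ) + w(t))`, expresses
the first factor as an integral of the derivative over `(t,t+δ)`, integrates in `t`, exchanges the
integrals and lets `δ → 0`, using continuity of translations in `L²`. -/

/-! ### Test functions and weak derivatives on an interval -/

lemma IsTestFunction.continuous {E : Type*} [NormedAddCommGroup E] [NormedSpace ℝ E]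
    {U : Set E} {φ : E → ℝ} (hφ : IsTestFunction U φ) : Continuous φ :=
  hφ.contDiff.continuous

lemma IsTestFunction.eq_zero_of_notMem {E : Type*} [NormedAddCommGroup E] [NormedSpace ℝ E]
    {U : Set E} {φ : E → ℝ} (hφ : IsTestFunction U φ) {x : E} (hx : x ∉ U) : φ x = 0 :=
  image_eq_zero_of_notMem_tsupport fun h => hx (hφ.tsupport_subset h)

lemma exists_isTestFunction_integral_eq_one {T : ℝ} (hT : 0 < T) :
    ∃ ρ : ℝ → ℝ, IsTestFunction (Ioo 0 T) ρ ∧ ∫ t in (0 : ℝ)..T, ρ t = 1 := by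
  let b : ContDiffBump (T / 2) := ⟨T / 8, T / 4, by positivity, by linarith⟩
  have hb : IsTestFunction (Ioo 0 T) (b.normed volume) := by
    refine ⟨b.contDiff_normed, b.hasCompactSupport_normed, ?_⟩
    rw [b.tsupport_normed_eq, Real.closedBall_eq_Icc]
    intro x hx
    have h1 : T / 2 - T / 4 ≤ x := hx.1
    have h2 : x ≤ T / 2 + T / 4 := hx.2
    constructor <;> linarith
  refine ⟨_, hb, ?_⟩
  rw [intervalIntegral.integral_of_le hT.le, setIntegral_eq_integral_of_forall_compl_eq_zero,
    b.integral_normed]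
  intro x hx
  exact hb.eq_zero_of_notMem fun h => hx (Ioo_subset_Ioc_self h)

/-- The primitive of a test function of vanishing mean is a test function. -/
lemma IsTestFunction.primitive {T : ℝ} {η : ℝ → ℝ} (hη : IsTestFunction (Ioo 0 T) η)
    (h0 : ∫ t in (0 : ℝ)..T, η t = 0) :
    IsTestFunction (Ioo 0 T) (fun t => ∫ s in (0 : ℝ)..t, η s) ∧
      deriv (fun t => ∫ s in (0 : ℝ)..t, η s) = η := by
  have hd : ∀ t, HasDerivAt (fun t => ∫ s in (0 : ℝ)..t, η s) (η t) t := fun t =>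
    intervalIntegral.integral_hasDerivAt_right (hη.continuous.intervalIntegrable _ _)
      (hη.continuous.stronglyMeasurableAtFilter _ _) hη.continuous.continuousAt
  have hderiv : deriv (fun t => ∫ s in (0 : ℝ)..t, η s) = η := funext fun t => (hd t).deriv
  have hsub : ∃ a b, 0 < a ∧ b < T ∧ tsupport η ⊆ Icc a b := by
    rcases (tsupport η).eq_empty_or_nonempty with he | hne
    -- For empty support only `0 < a` and `b < T` matter; `a ≤ b` is never used.
    · exact ⟨1, T - 1, by simp, by simp, by simp [he]⟩
    · have hK : IsCompact (tsupport η) := hη.hasCompactSupport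
      refine ⟨sInf (tsupport η), sSup (tsupport η), (hη.tsupport_subset (hK.sInf_mem hne)).1,
        (hη.tsupport_subset (hK.sSup_mem hne)).2, fun x hx => ⟨csInf_le hK.bddBelow hx,
          le_csSup hK.bddAbove hx⟩⟩
  obtain ⟨a, b, ha, hb, hab⟩ := hsub
  have hz : ∀ t ∉ Icc a b, η t = 0 := fun t ht =>
    image_eq_zero_of_notMem_tsupport fun h => ht (hab h)
  have hsupp : tsupport (fun t => ∫ s in (0 : ℝ)..t, η s) ⊆ Icc a b := by
    refine closure_minimal (Function.support_subset_iff'.2 fun t ht => ?_) isClosed_Icc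
    by_cases hta : t < a
    · apply intervalIntegral.integral_zero_ae
      refine Eventually.of_forall fun s hs => hz s fun h => ?_
      have := hs.2
      have := h.1
      rcases max_cases 0 t with hm | hm <;> linarith [hm.1, hm.2]
    · have htb : b < t := not_le.1 fun h => ht ⟨not_lt.1 hta, h⟩
      have hI := intervalIntegral.integral_add_adjacent_intervals
        (hη.continuous.intervalIntegrable (μ := volume) 0 t)
        (hη.continuous.intervalIntegrable (μ := volume) t T)
      have : ∫ s in t..T, η s = 0 := by
        apply intervalIntegral.integral_zero_ae
        refine Eventually.of_forall fun s hs => hz s fun h => ?_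
        have := hs.1
        have := h.2
        rcases min_cases t T with hm | hm <;> linarith [hm.1, hm.2]
      linarith
  refine ⟨⟨?_, HasCompactSupport.of_support_subset_isCompact isCompact_Icc
    (subset_closure.trans hsupp), fun x hx => ⟨ha.trans_le (hsupp hx).1, (hsupp hx).2.trans_lt hb⟩⟩,
    hderiv⟩
  rw [contDiff_infty_iff_deriv, hderiv]
  exact ⟨fun t => (hd t).differentiableAt, hη.contDiff⟩

lemma IsTestFunction.sub_smul {E : Type*} [NormedAddCommGroup E] [NormedSpace ℝ E] {U : Set E}
    {φ ψ : E → ℝ} (hφ : IsTestFunction U φ) (hψ : IsTestFunction U ψ) (c : ℝ) :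
    IsTestFunction U (fun x => φ x - c * ψ x) := by
  have hs : tsupport (fun x => φ x - c * ψ x) ⊆ tsupport φ ∪ tsupport ψ := by
    refine closure_minimal (Function.support_subset_iff'.2 fun x hx => ?_)
      ((isClosed_tsupport _).union (isClosed_tsupport _))
    simp [image_eq_zero_of_notMem_tsupport fun h => hx (Or.inl h),
      image_eq_zero_of_notMem_tsupport fun h => hx (Or.inr h)]
  exact ⟨hφ.contDiff.sub (contDiff_const.mul hψ.contDiff),
    (hφ.hasCompactSupport.isCompact.union hψ.hasCompactSupport.isCompact).of_isClosed_subset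
      (isClosed_tsupport _) hs, hs.trans (union_subset hφ.tsupport_subset hψ.tsupport_subset)⟩

/-- Du Bois-Reymond lemma: a continuous function with vanishing weak derivative is constant. -/
lemma eq_of_forall_integral_deriv_mul_eq_zero {T : ℝ} (hT : 0 < T) {z : ℝ → ℝ}
    (hz : ContinuousOn z (Icc 0 T))
    (h : ∀ ψ : ℝ → ℝ, IsTestFunction (Ioo 0 T) ψ → ∫ t in (0 : ℝ)..T, deriv ψ t * z t = 0) :
    ∀ t ∈ Icc 0 T, z t = z 0 := by
  obtain ⟨ρ, hρ, hρ1⟩ := exists_isTestFunction_integral_eq_one hT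
  set c := ∫ t in (0 : ℝ)..T, ρ t * z t with hc
  have hzi : IntervalIntegrable z volume 0 T := (by rwa [uIcc_of_le hT.le] :
    ContinuousOn z (uIcc 0 T)).intervalIntegrable
  have key : ∀ η : ℝ → ℝ, IsTestFunction (Ioo 0 T) η →
      ∫ t in (0 : ℝ)..T, η t * (z t - c) = 0 := by
    intro η hη
    set e := ∫ t in (0 : ℝ)..T, η t with he
    have hηi := hη.continuous.intervalIntegrable (μ := volume) 0 T
    have hρi := hρ.continuous.intervalIntegrable (μ := volume) 0 T
    have hηz := hzi.continuousOn_mul hη.continuous.continuousOn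
    have hρz := hzi.continuousOn_mul hρ.continuous.continuousOn
    -- Removing the mean with `ρ` makes the primitive a test function, so the hypothesis applies to
    -- it.
    have h0 : ∫ t in (0 : ℝ)..T, (η t - e * ρ t) = 0 := by
      rw [intervalIntegral.integral_sub hηi (hρi.const_mul e),
        intervalIntegral.integral_const_mul, hρ1, ← he]
      ring
    obtain ⟨h1, h2⟩ := (hη.sub_smul hρ e).primitive h0
    have h3 := h _ h1
    rw [h2] at h3
    have h4 : ∫ t in (0 : ℝ)..T, (η t - e * ρ t) * z t
        = (∫ t in (0 : ℝ)..T, η t * z t) - e * c := by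
      rw [hc, ← intervalIntegral.integral_const_mul, ← intervalIntegral.integral_sub hηz
        (hρz.const_mul e)]
      exact intervalIntegral.integral_congr fun t _ => by ring
    have h5 : ∫ t in (0 : ℝ)..T, η t * (z t - c)
        = (∫ t in (0 : ℝ)..T, η t * z t) - e * c := by
      rw [he, mul_comm, ← intervalIntegral.integral_const_mul, ← intervalIntegral.integral_sub hηz
        (hηi.const_mul c)]
      exact intervalIntegral.integral_congr fun t _ => by ring
    linarith
  have hae : ∀ᵐ t ∂(volume : Measure ℝ), t ∈ Ioo 0 T → z t - c = 0 := by
    refine isOpen_Ioo.ae_eq_zero_of_integral_contDiff_smul_eq_zero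
      (((hz.sub continuousOn_const).mono Ioo_subset_Icc_self).locallyIntegrableOn
        measurableSet_Ioo) fun η h1 h2 h3 => ?_
    have hη : IsTestFunction (Ioo 0 T) η := ⟨h1, h2, h3⟩
    rw [← key η hη, intervalIntegral.integral_of_le hT.le,
      setIntegral_eq_integral_of_forall_compl_eq_zero]
    · simp
    · intro x hx
      rw [hη.eq_zero_of_notMem fun h => hx (Ioo_subset_Ioc_self h), zero_mul]
  have heq : EqOn z (fun _ => c) (Icc 0 T) := by
    refine Measure.eqOn_Icc_of_ae_eq volume hT.ne ?_ hz continuousOn_const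
    rw [restrict_Ioo_eq_restrict_Icc.symm, EventuallyEq, ae_restrict_iff' measurableSet_Ioo]
    filter_upwards [hae] with t ht hmem
    exact sub_eq_zero.1 (ht hmem)
  intro t ht
  rw [heq ht, heq (left_mem_Icc.2 hT.le)]

/-- A continuous function with an integrable weak derivative is the primitive of the latter. -/
lemma sub_eq_integral_of_weakDeriv {T : ℝ} (hT : 0 < T) {v p : ℝ → ℝ}
    (hv : ContinuousOn v (Icc 0 T)) (hp : IntervalIntegrable p volume 0 T)
    (h : ∀ ψ : ℝ → ℝ, IsTestFunction (Ioo 0 T) ψ →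
      ∫ t in (0 : ℝ)..T, deriv ψ t * v t = - ∫ t in (0 : ℝ)..T, ψ t * p t) :
    ∀ t ∈ Icc 0 T, v t - v 0 = ∫ s in (0 : ℝ)..t, p s := by
  set q : ℝ → ℝ := fun t => ∫ s in (0 : ℝ)..t, p s with hq
  have hqac : AbsolutelyContinuousOnInterval q 0 T :=
    hp.absolutelyContinuousOnInterval_intervalIntegral left_mem_uIcc
  have hqc : ContinuousOn q (Icc 0 T) := by simpa [uIcc_of_le hT.le] using hqac.continuousOn
  have hvi : IntervalIntegrable v volume 0 T := (by rwa [uIcc_of_le hT.le] :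
    ContinuousOn v (uIcc 0 T)).intervalIntegrable
  -- The primitive `q` is only absolutely continuous, so the integration by parts is the one for
  -- such functions, with `q' = p` almost everywhere.
  have hconst := eq_of_forall_integral_deriv_mul_eq_zero hT (hv.sub hqc) fun ψ hψ => by
    have hψd : Continuous (deriv ψ) := hψ.contDiff.continuous_deriv (by simp)
    have hψac : AbsolutelyContinuousOnInterval ψ 0 T :=
      (hψ.contDiff.of_le (by simp)).contDiffOn.absolutelyContinuousOnInterval
    have hparts := hψac.integral_mul_deriv_eq_deriv_mul hqac
    rw [hψ.eq_zero_of_notMem (x := T) (by simp), hψ.eq_zero_of_notMem (x := 0) (by simp)] at hparts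
    have hpp : ∫ t in (0 : ℝ)..T, ψ t * deriv q t = ∫ t in (0 : ℝ)..T, ψ t * p t := by
      apply intervalIntegral.integral_congr_ae
      filter_upwards [hp.ae_hasDerivAt_integral] with t ht hmem
      rw [(ht (uIoc_subset_uIcc hmem) 0 left_mem_uIcc).deriv]
    have hsub : ∫ t in (0 : ℝ)..T, deriv ψ t * (v - q) t
        = (∫ t in (0 : ℝ)..T, deriv ψ t * v t) - ∫ t in (0 : ℝ)..T, deriv ψ t * q t := by
      rw [← intervalIntegral.integral_sub (hvi.continuousOn_mul hψd.continuousOn)]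
      · exact intervalIntegral.integral_congr fun t _ => by simp [mul_sub]
      · exact (ContinuousOn.intervalIntegrable (by rwa [uIcc_of_le hT.le])).continuousOn_mul
          hψd.continuousOn
    rw [hsub, h ψ hψ]
    linarith
  intro t ht
  have := hconst t ht
  have hq0 : q 0 = 0 := by simp [hq]
  simp only [Pi.sub_apply, hq0] at this
  change v t - v 0 = q t
  linarith

/-! ### The energy identity on the line -/

section Energy

variable {V : Type*} [NormedAddCommGroup V] [NormedSpace ℝ V]

/-- Translation is continuous in `L²`. -/
lemma continuous_toLp_translate {E : Type*} [NormedAddCommGroup E] {f : ℝ → E}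
    (hf : MemLp f 2 volume) :
    Continuous (fun r : ℝ =>
      (hf.comp_measurePreserving (measurePreserving_add_right volume r)).toLp) := by
  have hg : Continuous (fun r : ℝ => (⟨(· + r), by fun_prop⟩ : C(ℝ, ℝ))) :=
    ContinuousMap.continuous_of_continuous_uncurry _
      (by simp only [Function.uncurry_def, ContinuousMap.coe_mk]; fun_prop)
  exact (continuous_const (y := hf.toLp f)).compMeasurePreservingLp hg
    (fun r => measurePreserving_add_right volume r) (by simp)

/-- The duality pairing is a bounded bilinear form on `L²(V*) × L²(V)`, and each translate depends
continuously on its shift. This supplies the limit `δ → 0` in the energy identity. -/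
lemma continuous_integral_translate {U : ℝ → V} {P : ℝ → StrongDual ℝ V}
    (hU : MemLp U 2 volume) (hP : MemLp P 2 volume) (s : Set ℝ) :
    Continuous (fun q : ℝ × ℝ => ∫ t in s, P (t + q.1) (U (t + q.2))) := by
  let R := LpToLpRestrictCLM ℝ V ℝ volume 2 s
  let R' := LpToLpRestrictCLM ℝ (StrongDual ℝ V) ℝ volume 2 s
  let B := (ContinuousLinearMap.id ℝ (StrongDual ℝ V)).lpPairing (volume.restrict s) 2 2
  have h1 := (continuous_toLp_translate hP).comp (continuous_fst (X := ℝ) (Y := ℝ))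
  have h2 := (continuous_toLp_translate hU).comp (continuous_snd (X := ℝ) (Y := ℝ))
  have h3 := (B.continuous.comp (R'.continuous.comp h1)).clm_apply (R.continuous.comp h2)
  convert! h3 using 2 with q
  simp only [Function.comp_apply, B, ContinuousLinearMap.lpPairing_eq_integral]
  apply integral_congr_ae
  filter_upwards [LpToLpRestrictCLM_coeFn ℝ s
      (hU.comp_measurePreserving (measurePreserving_add_right volume q.2)).toLp,
    LpToLpRestrictCLM_coeFn ℝ s
      (hP.comp_measurePreserving (measurePreserving_add_right volume q.1)).toLp,
    ae_restrict_of_ae (hU.comp_measurePreserving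
      (measurePreserving_add_right volume q.2)).coeFn_toLp,
    ae_restrict_of_ae (hP.comp_measurePreserving
      (measurePreserving_add_right volume q.1)).coeFn_toLp] with t a1 a2 a3 a4
  simp only [R, R', a1, a2, a3, a4]
  rfl

/-- Justifies Fubini in the energy identity: by translation invariance the inner integral of the
norm is at most `‖U t‖` times the `L¹` norm of `P`. -/
lemma integrable_prod_translate_apply {U : ℝ → V} {P : ℝ → StrongDual ℝ V}
    (hUm : StronglyMeasurable U) (hPm : StronglyMeasurable P)
    (hU : Integrable U) (hP : Integrable P) (s s' : Set ℝ) :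
    Integrable (fun q : ℝ × ℝ => P (q.1 + q.2) (U q.1))
      ((volume.restrict s).prod (volume.restrict s')) := by
  have hm : StronglyMeasurable (fun q : ℝ × ℝ => P (q.1 + q.2) (U q.1)) :=
    isBoundedBilinearMap_apply.continuous.comp_stronglyMeasurable
      ((hPm.comp_measurable (measurable_fst.add measurable_snd)).prodMk
        (hUm.comp_measurable measurable_fst))
  have hPt : ∀ t, Integrable (fun r => P (t + r)) := fun t => hP.comp_add_left t
  have hi : ∀ t, Integrable (fun r => P (t + r) (U t)) (volume.restrict s') := fun t =>
    ((hPt t).apply_continuousLinearMap (U t)).restrict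
  rw [integrable_prod_iff hm.aestronglyMeasurable]
  refine ⟨Eventually.of_forall hi, ?_⟩
  refine ((hU.restrict (s := s)).norm.mul_const (∫ r, ‖P r‖)).mono'
    hm.aestronglyMeasurable.norm.integral_prod_right' (Eventually.of_forall fun t => ?_)
  rw [Real.norm_of_nonneg (integral_nonneg fun _ => norm_nonneg _)]
  calc ∫ r in s', ‖P (t + r) (U t)‖ ≤ ∫ r in s', ‖U t‖ * ‖P (t + r)‖ :=
        integral_mono (hi t).norm ((hPt t).norm.const_mul _).restrict fun r =>
          (ContinuousLinearMap.le_opNorm _ _).trans_eq (mul_comm _ _)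
    _ ≤ ∫ r, ‖U t‖ * ‖P (t + r)‖ :=
        setIntegral_le_integral ((hPt t).norm.const_mul _)
          (Eventually.of_forall fun r => by positivity)
    _ = ‖U t‖ * ∫ r, ‖P r‖ := by
        rw [integral_const_mul, integral_add_left_eq_self (fun r => ‖P r‖) t]

/-- Averages over a short interval are close to the value at an end. In this form no limit of
difference quotients has to be taken. -/
lemma abs_integral_sub_const_mul_le {f : ℝ → ℝ} {a δ c ε : ℝ} (hδ : 0 ≤ δ)
    (hf : IntervalIntegrable f volume a (a + δ))
    (h : ∀ t ∈ Icc a (a + δ), |f t - c| ≤ ε) :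
    |(∫ t in a..(a + δ), f t) - c * δ| ≤ ε * δ := by
  have h1 : (∫ t in a..(a + δ), f t) - c * δ = ∫ t in a..(a + δ), (f t - c) := by
    rw [intervalIntegral.integral_sub hf (by simp)]
    simp [mul_comm]
  rw [h1]
  have h2 := intervalIntegral.norm_integral_le_of_norm_le_const (a := a) (b := a + δ)
    (f := fun t => f t - c) (C := ε) fun t ht => by
      rw [uIoc_of_le (by linarith)] at ht
      exact h t (Ioc_subset_Icc_self ht)
  simpa [abs_of_nonneg hδ] using h2

variable {H : Type*} [NormedAddCommGroup H] [InnerProductSpace ℝ H]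

/-- Energy identity in a Gelfand triple, for a curve starting at `0`. -/
theorem norm_sq_eq_two_mul_integral (j : V →L[ℝ] H) {T : ℝ} {U : ℝ → V}
    {P : ℝ → StrongDual ℝ V} (hUm : StronglyMeasurable U) (hPm : StronglyMeasurable P)
    (hU : MemLp U 2 volume) (hP : MemLp P 2 volume) (hU1 : Integrable U) (hP1 : Integrable P)
    {w : ℝ → H} (hw : ContinuousOn w (Icc 0 T)) (hwU : ∀ᵐ t, t ∈ Ioo 0 T → w t = j (U t))
    (hw0 : w 0 = 0)
    (hwP : ∀ φ, ∀ t ∈ Icc 0 T, ⟪w t, j φ⟫_ℝ = ∫ s in (0 : ℝ)..t, P s φ) :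
    ∀ τ ∈ Ico 0 T, ‖w τ‖ ^ 2 = 2 * ∫ s in (0 : ℝ)..τ, P s (U s) := by
  intro τ hτ
  have hτ0 : 0 ≤ τ := hτ.1
  have hτT : τ < T := hτ.2
  set G0 := ∫ t in Ioc 0 τ, P t (U t) with hG0
  rw [intervalIntegral.integral_of_le hτ.1, ← hG0]
  set G : ℝ × ℝ → ℝ := fun q => ∫ t in Ioc 0 τ, P (t + q.1) (U (t + q.2)) with hG
  have hGc : Continuous G := continuous_integral_translate hU hP _
  have hw2 : ContinuousOn (fun t => ‖w t‖ ^ 2) (Icc 0 T) := hw.norm.pow 2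
  -- One `δ` serves continuity of `‖w‖²` at `0` and at `τ` and of `G` at the origin. Keeping `τ + δ`
  -- inside the interval is what excludes `τ = T`.
  have happrox : ∀ ε > 0, ∃ δ > 0, τ + δ < T ∧
      (∀ t ∈ Icc 0 δ, |‖w t‖ ^ 2 - 0| ≤ ε) ∧
      (∀ t ∈ Icc τ (τ + δ), |‖w t‖ ^ 2 - ‖w τ‖ ^ 2| ≤ ε) ∧
      (∀ r ∈ Icc 0 δ, |(G (r, δ) + G (r, 0)) - 2 * G0| ≤ ε) := by
    intro ε hε
    obtain ⟨d1, hd1, h1⟩ := Metric.continuousWithinAt_iff.1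
      (hw2 0 ⟨le_rfl, hτ0.trans hτT.le⟩) ε hε
    obtain ⟨d2, hd2, h2⟩ := Metric.continuousWithinAt_iff.1 (hw2 τ ⟨hτ0, hτT.le⟩) ε hε
    obtain ⟨d3, hd3, h3⟩ := Metric.continuousAt_iff.1 (hGc.continuousAt (x := (0, 0)))
      (ε / 2) (by positivity)
    have hG00 : G (0, 0) = G0 := by simp [hG, hG0]
    refine ⟨min (min d1 d2) (min d3 (T - τ)) / 2, ?_, ?_, ?_, ?_, ?_⟩
    · have := sub_pos.2 hτT
      positivity
    all_goals
      have hTτ : 0 < T - τ := sub_pos.2 hτT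
      have hmpos : 0 < min (min d1 d2) (min d3 (T - τ)) := by positivity
      have e1 : min (min d1 d2) (min d3 (T - τ)) ≤ d1 := (min_le_left _ _).trans (min_le_left _ _)
      have e2 : min (min d1 d2) (min d3 (T - τ)) ≤ d2 := (min_le_left _ _).trans (min_le_right _ _)
      have e3 : min (min d1 d2) (min d3 (T - τ)) ≤ d3 := (min_le_right _ _).trans (min_le_left _ _)
      have e4 : min (min d1 d2) (min d3 (T - τ)) ≤ T - τ :=
        (min_le_right _ _).trans (min_le_right _ _)
      generalize min (min d1 d2) (min d3 (T - τ)) = d at *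
    · linarith
    · intro t ht
      have := h1 (x := t) ⟨ht.1, by linarith [ht.2]⟩
        (by rw [Real.dist_eq, sub_zero, abs_of_nonneg ht.1]; linarith [ht.2])
      rw [Real.dist_eq, hw0] at this
      simpa using this.le
    · intro t ht
      have := h2 (x := t) ⟨by linarith [ht.1], by linarith [ht.2]⟩
        (by rw [Real.dist_eq, abs_of_nonneg (by linarith [ht.1])]; linarith [ht.2])
      exact this.le
    · intro r hr
      have a1 := h3 (x := (r, d / 2)) (by
        rw [Prod.dist_eq, max_lt_iff, Real.dist_eq, Real.dist_eq, sub_zero, sub_zero,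
          abs_of_nonneg hr.1, abs_of_nonneg (by linarith)]
        constructor <;> linarith [hr.2])
      have a2 := h3 (x := (r, 0)) (by
        rw [Prod.dist_eq, max_lt_iff, Real.dist_eq, Real.dist_eq, sub_zero, sub_zero,
          abs_of_nonneg hr.1, abs_zero]
        constructor <;> linarith [hr.2])
      rw [Real.dist_eq, hG00, abs_lt] at a1 a2
      rw [abs_le]
      constructor <;> linarith
  -- Both sides are the integral over `(0,τ)` of `‖w(t+δ)‖² - ‖w(t)‖²`: the left by shifting the
  -- interval, the right by Fubini.
  have hident : ∀ δ > 0, τ + δ < T →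
      (∫ t in τ..(τ + δ), ‖w t‖ ^ 2) - (∫ t in (0 : ℝ)..(0 + δ), ‖w t‖ ^ 2)
        = ∫ r in (0 : ℝ)..(0 + δ), (G (r, δ) + G (r, 0)) := by
    intro δ hδ hδT
    have hii : ∀ a b, 0 ≤ a → a ≤ b → b ≤ T →
        IntervalIntegrable (fun t => ‖w t‖ ^ 2) volume a b := fun a b ha hab hb =>
      (hw2.mono (by rw [uIcc_of_le hab]; exact Icc_subset_Icc ha hb)).intervalIntegrable
    set ξ : ℝ → V := fun t => U (t + δ) + U t with hξ
    have hξm : StronglyMeasurable ξ :=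
      (hUm.comp_measurable (measurable_id.add_const δ)).add hUm
    have hξ1 : Integrable ξ := (hU1.comp_add_right δ).add hU1
    have hGξ : ∀ r, G (r, δ) + G (r, 0) = ∫ t in Ioc 0 τ, P (t + r) (ξ t) := by
      intro r
      have hPr := hP.comp_measurePreserving (measurePreserving_add_right volume r)
      have hint : ∀ d, Integrable (fun t => P (t + r) (U (t + d))) := fun d =>
        memLp_one_iff_integrable.1 ((ContinuousLinearMap.id ℝ (StrongDual ℝ V)).memLp_of_bilin 1
          hPr (hU.comp_measurePreserving (measurePreserving_add_right volume d)))
      simp only [hG]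
      rw [← integral_add (hint δ).restrict (hint 0).restrict]
      simp [hξ]
    have hLHS : (∫ t in τ..(τ + δ), ‖w t‖ ^ 2) - (∫ t in (0 : ℝ)..(0 + δ), ‖w t‖ ^ 2)
        = ∫ t in Ioc 0 τ, (‖w (t + δ)‖ ^ 2 - ‖w t‖ ^ 2) := by
      have a1 : ∫ t in (0 : ℝ)..τ, ‖w (t + δ)‖ ^ 2 = ∫ t in δ..(τ + δ), ‖w t‖ ^ 2 := by
        rw [intervalIntegral.integral_comp_add_right (fun t => ‖w t‖ ^ 2) δ, zero_add]
      have a2 : IntervalIntegrable (fun t => ‖w (t + δ)‖ ^ 2) volume 0 τ := by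
        have := (hii δ (τ + δ) hδ.le (by linarith) hδT.le).comp_add_right δ
        simpa using this
      have a3 := intervalIntegral.integral_add_adjacent_intervals
        (hii 0 δ le_rfl hδ.le (by linarith)) (hii δ (τ + δ) hδ.le (by linarith) hδT.le)
      have a4 := intervalIntegral.integral_add_adjacent_intervals
        (hii 0 τ le_rfl hτ0 hτT.le) (hii τ (τ + δ) hτ0 (by linarith) hδT.le)
      rw [← intervalIntegral.integral_of_le hτ0,
        intervalIntegral.integral_sub a2 (hii 0 τ le_rfl hτ0 hτT.le), a1, zero_add]
      linarith
    have hae : ∀ᵐ t ∂(volume.restrict (Ioc 0 τ)),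
        ‖w (t + δ)‖ ^ 2 - ‖w t‖ ^ 2 = ∫ r in Ioc 0 δ, P (t + r) (ξ t) := by
      have hwU' : ∀ᵐ t, t + δ ∈ Ioo 0 T → w (t + δ) = j (U (t + δ)) :=
        (measurePreserving_add_right volume δ).quasiMeasurePreserving.ae hwU
      rw [ae_restrict_iff' measurableSet_Ioc]
      filter_upwards [hwU, hwU'] with t h1 h2 ht
      have e1 := h1 ⟨ht.1, by linarith [ht.2]⟩
      have e2 := h2 ⟨by linarith [ht.1], by linarith [ht.2]⟩
      -- Pairing with the sum makes the cross terms cancel. For fixed `t` the vector `ξ t` is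
      -- constant in the integration variable, so `hwP` applies to it.
      have e3 : ‖w (t + δ)‖ ^ 2 - ‖w t‖ ^ 2 = ⟪w (t + δ), j (ξ t)⟫_ℝ - ⟪w t, j (ξ t)⟫_ℝ := by
        have : j (ξ t) = w (t + δ) + w t := by rw [hξ, e1, e2, map_add]
        rw [this, inner_add_right, inner_add_right, real_inner_self_eq_norm_sq,
          real_inner_self_eq_norm_sq, real_inner_comm (w t) (w (t + δ))]
        ring
      have hPi : ∀ a b, IntervalIntegrable (fun s => P s (ξ t)) volume a b := fun a b =>
        (hP1.apply_continuousLinearMap (ξ t)).intervalIntegrable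
      rw [e3, hwP _ _ ⟨by linarith [ht.1], by linarith [ht.2]⟩,
        hwP _ _ ⟨ht.1.le, by linarith [ht.2]⟩,
        intervalIntegral.integral_interval_sub_left (hPi _ _) (hPi _ _),
        ← intervalIntegral.integral_of_le hδ.le,
        intervalIntegral.integral_comp_add_left (fun s => P s (ξ t)) t, add_zero]
    have hprod := integrable_prod_translate_apply hξm hPm hξ1 hP1 (Ioc 0 τ) (Ioc 0 δ)
    rw [hLHS, integral_congr_ae hae, zero_add, intervalIntegral.integral_of_le hδ.le]
    simp only [hGξ]
    exact integral_integral_swap hprod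
  refine eq_of_forall_dist_le fun ε hε => ?_
  obtain ⟨δ, hδ, hδT, b1, b2, b3⟩ := happrox (ε / 3) (by positivity)
  have hii : ∀ a b, 0 ≤ a → a ≤ b → b ≤ T →
      IntervalIntegrable (fun t => ‖w t‖ ^ 2) volume a b := fun a b ha hab hb =>
    (hw2.mono (by rw [uIcc_of_le hab]; exact Icc_subset_Icc ha hb)).intervalIntegrable
  have c1 := abs_integral_sub_const_mul_le hδ.le
    (hii 0 (0 + δ) le_rfl (by linarith) (by linarith)) (by rw [zero_add]; exact b1)
  have c2 := abs_integral_sub_const_mul_le hδ.le (hii τ (τ + δ) hτ0 (by linarith) hδT.le) b2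
  have hGi : Continuous fun r => G (r, δ) + G (r, 0) := by fun_prop
  have c3 := abs_integral_sub_const_mul_le hδ.le (hGi.intervalIntegrable 0 (0 + δ))
    (by rw [zero_add]; exact b3)
  rw [← hident δ hδ hδT] at c3
  rw [Real.dist_eq]
  rw [abs_le] at c1 c2 c3
  -- Three errors of size `ε / 3 * δ`: the averages of `‖w‖²` at `τ` and at `0`, and that of `G`.
  have hfin : |‖w τ‖ ^ 2 - 2 * G0| * δ ≤ ε * δ := by
    rw [← abs_of_pos hδ, ← abs_mul, abs_of_pos hδ, abs_le]
    constructor <;> linarith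
  exact le_of_mul_le_mul_right hfin hδ

end Energy

/-! ### Square-integrable functions -/

/-- The Cauchy-Schwarz inequality in `L²`. -/
lemma integral_norm_mul_norm_le {α E F : Type*} [MeasurableSpace α] {μ : Measure α}
    [NormedAddCommGroup E] [NormedAddCommGroup F] {f : α → E} {g : α → F}
    (hf : MemLp f 2 μ) (hg : MemLp g 2 μ) :
    ∫ x, ‖f x‖ * ‖g x‖ ∂μ ≤ √(∫ x, ‖f x‖ ^ 2 ∂μ) * √(∫ x, ‖g x‖ ^ 2 ∂μ) := by
  have h := integral_mul_norm_le_Lp_mul_Lq (μ := μ) (f := fun x => ‖f x‖) (g := fun x => ‖g x‖)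
    Real.HolderConjugate.two_two (by simpa using hf.norm) (by simpa using hg.norm)
  simpa [Real.sqrt_eq_rpow] using h

lemma norm_eq_sqrt_integral {α E : Type*} [MeasurableSpace α] {μ : Measure α}
    [NormedAddCommGroup E] (f : Lp E 2 μ) : ‖f‖ = √(∫ x, ‖f x‖ ^ 2 ∂μ) := by
  rw [Lp.norm_def, (Lp.memLp f).eLpNorm_eq_integral_rpow_norm (by simp) (by simp),
    ENNReal.toReal_ofReal (by positivity)]
  simp [Real.sqrt_eq_rpow]

lemma integrable_L2Time {T : ℝ} {X : Type*} [NormedAddCommGroup X] (f : L2Time T X) :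
    Integrable f (timeMeasure T) :=
  (Lp.memLp f).integrable (by simp)

lemma integrable_indicator_L2Time {T : ℝ} {X : Type*} [NormedAddCommGroup X] (f : L2Time T X) :
    Integrable ((Ioo 0 T).indicator f) volume :=
  (integrable_indicator_iff measurableSet_Ioo).2 (integrable_L2Time f)

/-! ### The energy identity on a bounded interval -/

section Energy

variable {V : Type*} [NormedAddCommGroup V] [NormedSpace ℝ V]
  {H : Type*} [NormedAddCommGroup H] [InnerProductSpace ℝ H]

/-- Energy identity for curves of `L²((0,T), V)` with weak derivative in `L²((0,T), V*)`. -/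
theorem norm_sq_eq_of_weakDeriv (j : V →L[ℝ] H) {T : ℝ} (hT : 0 < T) (u : L2Time T V)
    (p : L2Time T (StrongDual ℝ V)) {w : ℝ → H} (hw : ContinuousOn w (Icc 0 T))
    (hwu : ∀ᵐ t ∂(timeMeasure T), w t = j (u t)) (hw0 : w 0 = 0)
    (hp : ∀ φ : V, ∀ ψ : ℝ → ℝ, IsTestFunction (Ioo 0 T) ψ →
      ∫ t in Ioo 0 T, deriv ψ t * ⟪j (u t), j φ⟫_ℝ = - ∫ t in Ioo 0 T, ψ t * p t φ) :
    ∀ τ ∈ Ico 0 T, ‖w τ‖ ^ 2 = 2 * ∫ s in (0 : ℝ)..τ, p s (u s) := by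
  have hp1 : Integrable p (timeMeasure T) := integrable_L2Time p
  have hcongr : ∀ (f g : ℝ → ℝ) (t : ℝ), t ∈ Icc 0 T → (∀ s ∈ Ioo 0 T, f s = g s) →
      ∫ s in (0 : ℝ)..t, f s = ∫ s in (0 : ℝ)..t, g s := by
    intro f g t ht h
    rw [intervalIntegral.integral_of_le ht.1, intervalIntegral.integral_of_le ht.1,
      integral_Ioc_eq_integral_Ioo, integral_Ioc_eq_integral_Ioo]
    exact setIntegral_congr_fun measurableSet_Ioo fun s hs => h s ⟨hs.1, hs.2.trans_le ht.2⟩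
  -- Extension by zero makes translations available on the whole line.
  set U : ℝ → V := (Ioo 0 T).indicator u with hU
  set P : ℝ → StrongDual ℝ V := (Ioo 0 T).indicator p with hP
  have hUs : ∀ s ∈ Ioo 0 T, U s = u s := fun s hs => indicator_of_mem hs _
  have hPs : ∀ s ∈ Ioo 0 T, P s = p s := fun s hs => indicator_of_mem hs _
  have hwu' : ∀ᵐ t, t ∈ Ioo 0 T → w t = j (u t) := (ae_restrict_iff' measurableSet_Ioo).1 hwu
  have hwU : ∀ᵐ t, t ∈ Ioo 0 T → w t = j (U t) := by
    filter_upwards [hwu'] with t ht hmem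
    rw [hUs t hmem, ht hmem]
  have hwP : ∀ φ, ∀ t ∈ Icc 0 T, ⟪w t, j φ⟫_ℝ = ∫ s in (0 : ℝ)..t, P s φ := by
    intro φ t ht
    rw [hcongr (fun s => P s φ) (fun s => p s φ) t ht fun s hs => by rw [hPs s hs]]
    have hpφ : IntervalIntegrable (fun s => p s φ) volume 0 T :=
      (intervalIntegrable_iff_integrableOn_Ioo_of_le hT.le).2
        (ContinuousLinearMap.integrable_comp (ContinuousLinearMap.apply ℝ ℝ φ) hp1)
    have hwφ : ContinuousOn (fun t => ⟪w t, j φ⟫_ℝ) (Icc 0 T) := hw.inner continuousOn_const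
    have := sub_eq_integral_of_weakDeriv hT hwφ hpφ (fun ψ hψ => by
      rw [intervalIntegral.integral_of_le hT.le, intervalIntegral.integral_of_le hT.le,
        integral_Ioc_eq_integral_Ioo, integral_Ioc_eq_integral_Ioo, ← hp φ ψ hψ]
      apply integral_congr_ae
      filter_upwards [hwu] with s hs
      rw [hs]) t ht
    simpa only [hw0, inner_zero_left, sub_zero] using this
  have hUm : StronglyMeasurable U := (Lp.stronglyMeasurable u).indicator measurableSet_Ioo
  have hPm : StronglyMeasurable P := (Lp.stronglyMeasurable p).indicator measurableSet_Ioo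
  have hU2 : MemLp U 2 volume := (memLp_indicator_iff_restrict measurableSet_Ioo).2 (Lp.memLp u)
  have hP2 : MemLp P 2 volume := (memLp_indicator_iff_restrict measurableSet_Ioo).2 (Lp.memLp p)
  have hU1 : Integrable U volume := integrable_indicator_L2Time u
  have hP1 : Integrable P volume := integrable_indicator_L2Time p
  intro τ hτ
  rw [norm_sq_eq_two_mul_integral j hUm hPm hU2 hP2 hU1 hP1 hw hwU hw0 hwP τ hτ,
    hcongr (fun s => P s (U s)) (fun s => p s (u s)) τ (Ico_subset_Icc_self hτ)
    fun s hs => by rw [hPs s hs, hUs s hs]]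

end Energy

/-! ### Convolution in time -/

/-- Time reversal preserves square integrability on `(0,t)`. -/
lemma measurePreserving_sub_left_Ioo (t : ℝ) :
    MeasurePreserving (fun s => t - s) (volume.restrict (Ioo 0 t)) (volume.restrict (Ioo 0 t)) := by
  have h := (Measure.measurePreserving_sub_left (volume : Measure ℝ) t).restrict_preimage
    (measurableSet_Ioo (a := 0) (b := t))
  have h2 : (fun s => t - s) ⁻¹' Ioo 0 t = Ioo 0 t := by
    ext s
    simp only [mem_preimage, mem_Ioo]
    constructor <;> rintro ⟨h1, h2⟩ <;> constructor <;> linarith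
  rwa [h2] at h

section Convolution

variable {X : Type*} [NormedAddCommGroup X] [NormedSpace ℝ X]

lemma intervalIntegrable_timeConv {T t : ℝ} (ht : t ∈ Icc 0 T) {k : ℝ → ℝ} {v : ℝ → X}
    (hk : MemLp k 2 (timeMeasure T)) (hv : MemLp v 2 (timeMeasure T)) :
    IntervalIntegrable (fun s => k (t - s) • v s) volume 0 t := by
  rw [intervalIntegrable_iff_integrableOn_Ioo_of_le ht.1]
  have hle : volume.restrict (Ioo 0 t) ≤ timeMeasure T :=
    Measure.restrict_mono (Ioo_subset_Ioo_right ht.2) le_rfl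
  have h1 := (hk.mono_measure hle).comp_measurePreserving (measurePreserving_sub_left_Ioo t)
  exact memLp_one_iff_integrable.1 ((hv.mono_measure hle).smul h1)

/-- Cauchy-Schwarz on `(0,t)` after the reflection `s ↦ t - s`. Only values before time `t` enter,
as Grönwall's argument requires. -/
lemma norm_timeConv_le {T t : ℝ} (ht : t ∈ Icc 0 T) {k : ℝ → ℝ} {v : ℝ → X}
    (hk : MemLp k 2 (timeMeasure T)) (hv : MemLp v 2 (timeMeasure T)) :
    ‖timeConv k v t‖
      ≤ √(∫ s in (0 : ℝ)..t, k s ^ 2) * √(∫ s in (0 : ℝ)..t, ‖v s‖ ^ 2) := by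
  have hle : volume.restrict (Ioo 0 t) ≤ timeMeasure T :=
    Measure.restrict_mono (Ioo_subset_Ioo_right ht.2) le_rfl
  have h1 := (hk.mono_measure hle).comp_measurePreserving (measurePreserving_sub_left_Ioo t)
  have h2 := integral_norm_mul_norm_le h1 (hv.mono_measure hle)
  have h3 : ∫ s in Ioo 0 t, ‖(k ∘ fun s => t - s) s‖ ^ 2 = ∫ s in (0 : ℝ)..t, k s ^ 2 := by
    have := intervalIntegral.integral_comp_sub_left (a := 0) (b := t) (fun s => k s ^ 2) t
    rw [sub_self, sub_zero] at this
    rw [← this, intervalIntegral.integral_of_le ht.1, integral_Ioc_eq_integral_Ioo]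
    simp
  rw [h3] at h2
  rw [intervalIntegral.integral_of_le ht.1 (f := fun s => ‖v s‖ ^ 2), integral_Ioc_eq_integral_Ioo]
  refine le_trans ?_ h2
  rw [timeConv, intervalIntegral.integral_of_le ht.1, integral_Ioc_eq_integral_Ioo]
  refine (norm_integral_le_integral_norm _).trans_eq ?_
  simp [norm_smul]

/-- Each term on the right contains exactly one difference, so the nonlinear dependence on the pair
is estimated linearly. -/
lemma timeConv_sub_timeConv {T t : ℝ} (ht : t ∈ Icc 0 T) {k₁ k₂ : ℝ → ℝ} {v₁ v₂ : ℝ → X}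
    (hk₁ : MemLp k₁ 2 (timeMeasure T)) (hk₂ : MemLp k₂ 2 (timeMeasure T))
    (hv₁ : MemLp v₁ 2 (timeMeasure T)) (hv₂ : MemLp v₂ 2 (timeMeasure T)) :
    timeConv k₁ v₁ t - timeConv k₂ v₂ t
      = timeConv (k₁ - k₂) v₁ t + timeConv k₂ (v₁ - v₂) t := by
  simp only [timeConv]
  rw [← intervalIntegral.integral_sub (intervalIntegrable_timeConv ht hk₁ hv₁)
      (intervalIntegrable_timeConv ht hk₂ hv₂),
    ← intervalIntegral.integral_add (intervalIntegrable_timeConv ht (hk₁.sub hk₂) hv₁)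
      (intervalIntegrable_timeConv ht hk₂ (hv₁.sub hv₂))]
  refine intervalIntegral.integral_congr fun s _ => ?_
  simp only [Pi.sub_apply, sub_smul, smul_sub]
  abel

end Convolution

/-! ### Absorption and Grönwall's inequality -/

/-- Absorption of the mixed terms in the pointwise energy inequality. -/
lemma exists_absorption_constants {c : ℝ} (hc : 0 < c) (A B M L A' L' : ℝ) :
    ∃ η > 0, ∃ C ≥ 0, ∀ e k α β q r : ℝ, 0 ≤ k →
      c * k ≤ A' * q + L' * (α + β) →
      e ≤ -β ^ 2 + M * k * α + A * q * α + B * r * α + L * (α + β) * α →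
      e + η * k ^ 2 + β ^ 2 / 8 ≤ C * (α ^ 2 + q ^ 2 + r ^ 2) := by
  -- The constant in `k² ≤ D (q² + α² + β²)`, from squaring the bound on `c * k`; the `+ 1` keeps it
  -- positive.
  set D : ℝ := (3 * (A' ^ 2 + L' ^ 2) + 1) / c ^ 2 with hD
  have hD0 : 0 < D := by positivity
  -- The budget for `β²` is `1/4` for `M k α`, `1/8` for `η k²` and `1/2` for `L β α`, which leaves
  -- the `1/8` kept on the left.
  refine ⟨1 / (8 * D), by positivity, 1 + D * M ^ 2 + A ^ 2 / 2 + B ^ 2 / 2 + |L| + L ^ 2 / 2,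
    by positivity, fun e k α β q r hk h1 h2 => ?_⟩
  have h3 : k ^ 2 ≤ D * (q ^ 2 + α ^ 2 + β ^ 2) := by
    have a1 : (c * k) ^ 2 ≤ (A' * q + L' * (α + β)) ^ 2 := by gcongr
    have a2 : (A' * q + L' * (α + β)) ^ 2
        ≤ 3 * ((A' * q) ^ 2 + (L' * α) ^ 2 + (L' * β) ^ 2) := by
      nlinarith [sq_nonneg (A' * q - L' * α), sq_nonneg (A' * q - L' * β),
        sq_nonneg (L' * α - L' * β)]
    have a3 : 3 * ((A' * q) ^ 2 + (L' * α) ^ 2 + (L' * β) ^ 2)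
        ≤ (3 * (A' ^ 2 + L' ^ 2) + 1) * (q ^ 2 + α ^ 2 + β ^ 2) := by
      have : 0 ≤ q ^ 2 + α ^ 2 + β ^ 2 + 3 * (A' ^ 2 * (α ^ 2 + β ^ 2) + L' ^ 2 * q ^ 2) := by
        positivity
      linarith [this]
    rw [hD, div_mul_eq_mul_div, le_div_iff₀ (by positivity)]
    linarith
  have h4 : M * k * α ≤ k ^ 2 / (4 * D) + D * M ^ 2 * α ^ 2 := by
    have : k ^ 2 / (4 * D) + D * M ^ 2 * α ^ 2 - M * k * α = (k - 2 * D * M * α) ^ 2 / (4 * D) := by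
      field_simp
      ring
    have h5 : 0 ≤ (k - 2 * D * M * α) ^ 2 / (4 * D) := by positivity
    linarith
  have h5 : k ^ 2 / (4 * D) ≤ (q ^ 2 + α ^ 2 + β ^ 2) / 4 := by
    rw [div_le_div_iff₀ (by positivity) (by norm_num)]
    linarith
  have h6 : 1 / (8 * D) * k ^ 2 ≤ (q ^ 2 + α ^ 2 + β ^ 2) / 8 := by
    rw [div_mul_eq_mul_div, div_le_div_iff₀ (by positivity) (by norm_num)]
    linarith
  have h7 : L * α ^ 2 ≤ |L| * α ^ 2 := by gcongr; exact le_abs_self L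
  have h8 : 0 ≤ (D * M ^ 2 + A ^ 2 / 2 + B ^ 2 / 2 + |L| + L ^ 2 / 2) * (q ^ 2 + r ^ 2) := by
    positivity
  nlinarith [sq_nonneg (q - A * α), sq_nonneg (r - B * α), sq_nonneg (β - L * α), sq_nonneg α,
    sq_nonneg q, sq_nonneg r]

/-- Integral form of Grönwall's inequality with vanishing right-hand side. -/
lemma eq_zero_of_le_mul_integral {T C : ℝ} {φ : ℝ → ℝ} (hφ : ContinuousOn φ (Icc 0 T))
    (h0 : ∀ t ∈ Ico 0 T, 0 ≤ φ t) (h : ∀ t ∈ Ico 0 T, φ t ≤ C * ∫ s in (0 : ℝ)..t, φ s) :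
    ∀ t ∈ Ico 0 T, φ t = 0 := by
  intro t ht
  have hT : 0 ≤ T := ht.1.trans ht.2.le
  have hi : ∀ s ∈ Icc 0 T, IntervalIntegrable φ volume 0 s := fun s hs =>
    (hφ.mono (by rw [uIcc_of_le hs.1]; exact Icc_subset_Icc_right hs.2)).intervalIntegrable
  have hnn : ∀ s ∈ Ico 0 T, 0 ≤ ∫ x in (0 : ℝ)..s, φ x := fun s hs =>
    intervalIntegral.integral_nonneg hs.1 fun x hx => h0 x ⟨hx.1, hx.2.trans_lt hs.2⟩
  have hcont : ContinuousOn (fun s => ∫ x in (0 : ℝ)..s, φ x) (Icc 0 T) := by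
    simpa [uIcc_of_le hT] using
      intervalIntegral.continuousOn_primitive_interval' (hi T ⟨hT, le_rfl⟩) left_mem_uIcc
  have hderiv : ∀ s ∈ Ico 0 T,
      HasDerivWithinAt (fun s => ∫ x in (0 : ℝ)..s, φ x) (φ s) (Ici s) s := by
    intro s hs
    have hm : Icc 0 T ∈ 𝓝[>] s :=
      mem_of_superset (Ioo_mem_nhdsGT hs.2) fun x hx => ⟨hs.1.trans hx.1.le, hx.2.le⟩
    exact intervalIntegral.integral_hasDerivWithinAt_right (hi s (Ico_subset_Icc_self hs))
      ((hφ.stronglyMeasurableAtFilter_nhdsWithin measurableSet_Icc s).filter_mono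
        (nhdsWithin_le_of_mem hm))
      ((hφ s (Ico_subset_Icc_self hs)).mono_of_mem_nhdsWithin hm)
  -- The primitive of `φ` vanishes at `0` and bounds its own right derivative.
  have hz := eq_zero_of_abs_deriv_le_mul_abs_self_of_eq_zero_right hcont hderiv
    intervalIntegral.integral_same (fun s hs => by
      rw [Real.norm_of_nonneg (h0 s hs), Real.norm_of_nonneg (hnn s hs)]
      exact h s hs) t (Ico_subset_Icc_self ht)
  have := h t ht
  rw [hz, mul_zero] at this
  exact le_antisymm this (h0 t ht)

/-- A Grönwall argument for the coupled system of the energy `y` and the memory kernel `k`. -/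
lemma ae_eq_zero_of_energy_inequality {T c : ℝ} (hT : 0 < T) (hc : 0 < c) (A B M L A' L' : ℝ)
    {α β k e y : ℝ → ℝ} (hk0 : ∀ t, 0 ≤ k t)
    (hα : IntervalIntegrable (fun t => α t ^ 2) volume 0 T)
    (hβ : IntervalIntegrable (fun t => β t ^ 2) volume 0 T)
    (hk : IntervalIntegrable (fun t => k t ^ 2) volume 0 T)
    (he : IntervalIntegrable e volume 0 T) (hy : ContinuousOn y (Icc 0 T)) (hy0 : ∀ t, 0 ≤ y t)
    (hyα : ∀ᵐ t ∂(timeMeasure T), y t = α t ^ 2)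
    (hye : ∀ t ∈ Ico 0 T, y t = 2 * ∫ s in (0 : ℝ)..t, e s)
    (hkα : ∀ᵐ t ∂(timeMeasure T),
      c * k t ≤ A' * √(∫ s in (0 : ℝ)..t, k s ^ 2) + L' * (α t + β t))
    (heα : ∀ᵐ t ∂(timeMeasure T), e t ≤ -β t ^ 2 + M * k t * α t
      + A * √(∫ s in (0 : ℝ)..t, k s ^ 2) * α t + B * √(∫ s in (0 : ℝ)..t, α s ^ 2) * α t
      + L * (α t + β t) * α t) :
    ∀ᵐ t ∂(timeMeasure T), α t = 0 ∧ β t = 0 ∧ k t = 0 := by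
  obtain ⟨η, hη, C, hC, habs⟩ := exists_absorption_constants hc A B M L A' L'
  set Q : ℝ → ℝ := fun t => ∫ s in (0 : ℝ)..t, k s ^ 2 with hQ
  set Y : ℝ → ℝ := fun t => ∫ s in (0 : ℝ)..t, α s ^ 2 with hY
  set Z : ℝ → ℝ := fun t => ∫ s in (0 : ℝ)..t, β s ^ 2 with hZ
  -- Grönwall is applied to `y + Q`, which is continuous, whereas `α` and `k` are only square
  -- integrable.
  set Φ : ℝ → ℝ := fun t => ∫ s in (0 : ℝ)..t, (y s + Q s) with hΦ
  have hQc : ContinuousOn Q (Icc 0 T) := by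
    simpa [uIcc_of_le hT.le] using
      intervalIntegral.continuousOn_primitive_interval' hk left_mem_uIcc
  have hYc : ContinuousOn Y (Icc 0 T) := by
    simpa [uIcc_of_le hT.le] using
      intervalIntegral.continuousOn_primitive_interval' hα left_mem_uIcc
  have hsub : ∀ {f : ℝ → ℝ}, IntervalIntegrable f volume 0 T → ∀ t ∈ Icc 0 T,
      IntervalIntegrable f volume 0 t := fun hf t ht => hf.mono_set (by
    rw [uIcc_of_le ht.1, uIcc_of_le hT.le]; exact Icc_subset_Icc_right ht.2)
  have hcint : ∀ {f : ℝ → ℝ}, ContinuousOn f (Icc 0 T) → IntervalIntegrable f volume 0 T :=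
    fun hf => ContinuousOn.intervalIntegrable (by rwa [uIcc_of_le hT.le])
  have hQ0 : ∀ t ∈ Icc 0 T, 0 ≤ Q t := fun t ht =>
    intervalIntegral.integral_nonneg ht.1 fun s _ => sq_nonneg _
  have hY0 : ∀ t ∈ Icc 0 T, 0 ≤ Y t := fun t ht =>
    intervalIntegral.integral_nonneg ht.1 fun s _ => sq_nonneg _
  have hZ0 : ∀ t ∈ Icc 0 T, 0 ≤ Z t := fun t ht =>
    intervalIntegral.integral_nonneg ht.1 fun s _ => sq_nonneg _
  have hyi := hcint hy
  have hQi := hcint hQc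
  have hYi := hcint hYc
  have hYy : ∀ t ∈ Icc 0 T, Y t = ∫ s in (0 : ℝ)..t, y s := by
    intro t ht
    simp only [hY]
    rw [intervalIntegral.integral_of_le ht.1, intervalIntegral.integral_of_le ht.1,
      integral_Ioc_eq_integral_Ioo, integral_Ioc_eq_integral_Ioo]
    apply integral_congr_ae
    filter_upwards [ae_mono (Measure.restrict_mono (Ioo_subset_Ioo_right ht.2) le_rfl) hyα]
      with s hs
    rw [hs]
  have hΦeq : ∀ t ∈ Icc 0 T, Φ t = Y t + ∫ s in (0 : ℝ)..t, Q s := fun t ht => by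
    rw [hYy t ht, ← intervalIntegral.integral_add (hsub hyi t ht) (hsub hQi t ht)]
  -- `Y` is nondecreasing and at most `Φ`, so the memory of `u` costs only a factor `T`.
  have hYΦ : ∀ t ∈ Icc 0 T, ∫ s in (0 : ℝ)..t, Y s ≤ T * Φ t := by
    intro t ht
    have hQt : 0 ≤ ∫ s in (0 : ℝ)..t, Q s :=
      intervalIntegral.integral_nonneg ht.1 fun s hs => hQ0 s ⟨hs.1, hs.2.trans ht.2⟩
    have hYmono : ∀ s ∈ Icc 0 t, Y s ≤ Y t := fun s hs => by
      simp only [hY]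
      rw [← intervalIntegral.integral_add_adjacent_intervals (hsub hα s ⟨hs.1, hs.2.trans ht.2⟩)
        ((hsub hα s ⟨hs.1, hs.2.trans ht.2⟩).symm.trans (hsub hα t ht))]
      have : 0 ≤ ∫ x in s..t, α x ^ 2 :=
        intervalIntegral.integral_nonneg hs.2 fun _ _ => sq_nonneg _
      linarith
    calc ∫ s in (0 : ℝ)..t, Y s ≤ ∫ s in (0 : ℝ)..t, Y t :=
          intervalIntegral.integral_mono_on ht.1 (hsub hYi t ht) (by simp) hYmono
      _ = t * Y t := by simp
      _ ≤ T * Φ t := mul_le_mul ht.2 (by rw [hΦeq t ht]; linarith) (hY0 t ht) hT.le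
  have hmain : ∀ t ∈ Ico 0 T, y t / 2 + η * Q t + Z t / 8 ≤ C * (1 + T) * Φ t := by
    intro t ht
    have ht' := Ico_subset_Icc_self ht
    have hI : ∫ s in (0 : ℝ)..t, (e s + η * k s ^ 2 + β s ^ 2 / 8)
        ≤ ∫ s in (0 : ℝ)..t, C * (y s + Q s + Y s) := by
      rw [intervalIntegral.integral_of_le ht.1, intervalIntegral.integral_of_le ht.1,
        integral_Ioc_eq_integral_Ioo, integral_Ioc_eq_integral_Ioo]
      refine integral_mono_ae ?_ ?_ ?_
      · exact (intervalIntegrable_iff_integrableOn_Ioo_of_le ht.1).1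
          (((hsub he t ht').add ((hsub hk t ht').const_mul η)).add ((hsub hβ t ht').div_const 8))
      · exact (intervalIntegrable_iff_integrableOn_Ioo_of_le ht.1).1
          ((((hsub hyi t ht').add (hsub hQi t ht')).add (hsub hYi t ht')).const_mul C)
      · have hmono : volume.restrict (Ioo 0 t) ≤ timeMeasure T :=
          Measure.restrict_mono (Ioo_subset_Ioo_right ht.2.le) le_rfl
        filter_upwards [ae_mono hmono hyα, ae_mono hmono hkα, ae_mono hmono heα,
          ae_restrict_mem measurableSet_Ioo] with s h1 h2 h3 hs
        have hs' : s ∈ Icc 0 T := ⟨hs.1.le, hs.2.le.trans ht'.2⟩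
        have := habs _ _ _ _ _ _ (hk0 s) h2 h3
        rw [Real.sq_sqrt (hQ0 s hs'), Real.sq_sqrt (hY0 s hs'), ← h1] at this
        exact this
    rw [intervalIntegral.integral_add ((hsub he t ht').add ((hsub hk t ht').const_mul η))
        ((hsub hβ t ht').div_const 8),
      intervalIntegral.integral_add (hsub he t ht') ((hsub hk t ht').const_mul η),
      intervalIntegral.integral_const_mul, intervalIntegral.integral_const_mul,
      intervalIntegral.integral_div,
      intervalIntegral.integral_add ((hsub hyi t ht').add (hsub hQi t ht')) (hsub hYi t ht')] at hI
    have h1 := hye t ht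
    have h2 := mul_le_mul_of_nonneg_left (hYΦ t ht') hC
    have h3 : C * (∫ s in (0 : ℝ)..t, (y s + Q s)) = C * Φ t := rfl
    rw [mul_add, h3] at hI
    change (∫ s in (0 : ℝ)..t, e s) + η * Q t + Z t / 8 ≤ _ at hI
    linarith
  have hzero : ∀ t ∈ Ico 0 T, y t + Q t = 0 := by
    refine eq_zero_of_le_mul_integral (C := C * (1 + T) / min (1 / 2) η) (hy.add hQc)
      (fun t ht => add_nonneg (hy0 t) (hQ0 t (Ico_subset_Icc_self ht))) fun t ht => ?_
    rw [div_mul_eq_mul_div, le_div_iff₀ (by positivity)]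
    refine le_trans ?_ (hmain t ht)
    have a1 : min (1 / 2) η * y t ≤ 1 / 2 * y t :=
      mul_le_mul_of_nonneg_right (min_le_left _ _) (hy0 t)
    have a2 : min (1 / 2) η * Q t ≤ η * Q t :=
      mul_le_mul_of_nonneg_right (min_le_right _ _) (hQ0 t (Ico_subset_Icc_self ht))
    have a3 := hZ0 t (Ico_subset_Icc_self ht)
    linarith
  have hΦ0 : ∀ t ∈ Ico 0 T, Φ t = 0 := by
    intro t ht
    simp only [hΦ]
    rw [intervalIntegral.integral_congr (g := fun _ => (0 : ℝ)) fun s hs => ?_]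
    · simp
    · rw [uIcc_of_le ht.1] at hs
      exact hzero s ⟨hs.1, hs.2.trans_lt ht.2⟩
  have hsq : ∀ {f : ℝ → ℝ}, IntervalIntegrable (fun t => f t ^ 2) volume 0 T →
      (∀ t ∈ Ico 0 T, ∫ s in (0 : ℝ)..t, f s ^ 2 = 0) → ∀ᵐ t ∂(timeMeasure T), f t = 0 := by
    intro f hf h0
    have hcont : ContinuousOn (fun t => ∫ s in (0 : ℝ)..t, f s ^ 2) (Icc 0 T) := by
      simpa [uIcc_of_le hT.le] using
        intervalIntegral.continuousOn_primitive_interval' hf left_mem_uIcc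
    have hT0 : ∫ s in (0 : ℝ)..T, f s ^ 2 = 0 := by
      have h1 : EqOn (fun t => ∫ s in (0 : ℝ)..t, f s ^ 2) (fun _ => 0) (Icc 0 T) := by
        -- The estimates hold for `t < T` only; continuity of the primitive reaches the endpoint.
        refine EqOn.of_subset_closure (s := Ico 0 T) h0 hcont continuousOn_const
          Ico_subset_Icc_self ?_
        rw [closure_Ico hT.ne]
      exact h1 (right_mem_Icc.2 hT.le)
    rw [intervalIntegral.integral_of_le hT.le, integral_Ioc_eq_integral_Ioo,
      integral_eq_zero_iff_of_nonneg (fun _ => sq_nonneg _)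
        ((intervalIntegrable_iff_integrableOn_Ioo_of_le hT.le).1 hf)] at hT0
    filter_upwards [hT0] with t ht
    simpa using ht
  have hk' : ∀ᵐ t ∂(timeMeasure T), k t = 0 := hsq hk fun t ht => by
    have a1 := hzero t ht
    have a2 := hy0 t
    have a3 := hQ0 t (Ico_subset_Icc_self ht)
    change Q t = 0
    linarith
  have hβ' : ∀ᵐ t ∂(timeMeasure T), β t = 0 := hsq hβ fun t ht => by
    have a1 := hmain t ht
    rw [hΦ0 t ht, mul_zero] at a1
    have a2 := hy0 t
    have a3 := mul_nonneg hη.le (hQ0 t (Ico_subset_Icc_self ht))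
    have a4 := hZ0 t (Ico_subset_Icc_self ht)
    change Z t = 0
    linarith
  filter_upwards [hk', hβ', hyα, ae_restrict_mem measurableSet_Ioo] with t h1 h2 h3 ht
  refine ⟨?_, h2, h1⟩
  have a1 := hzero t (Ioo_subset_Ico_self ht)
  have a2 := hy0 t
  have a3 := hQ0 t (Ioo_subset_Icc_self ht)
  have : α t ^ 2 = 0 := by rw [← h3]; linarith
  simpa using this

/-! ### Structure of `H¹(Ω)` and uniqueness of weak derivatives -/

/-- The inclusion `H¹(Ω) ⊆ L²(Ω)` as a continuous linear map. -/
def toL2L {N : ℕ} (Ω : Set (Space N)) : H1 Ω →L[ℝ] L2 Ω :=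
  (WithLp.fstL 2 ℝ (L2 Ω) (L2Vec Ω)).comp (H1 Ω).subtypeL

/-- The weak gradient as a continuous linear map on `H¹(Ω)`. -/
def weakGradL {N : ℕ} (Ω : Set (Space N)) : H1 Ω →L[ℝ] L2Vec Ω :=
  (WithLp.sndL 2 ℝ (L2 Ω) (L2Vec Ω)).comp (H1 Ω).subtypeL

lemma toL2L_apply {N : ℕ} {Ω : Set (Space N)} (v : H1 Ω) : toL2L Ω v = toL2 v := rfl

lemma toL2_sub {N : ℕ} {Ω : Set (Space N)} (v w : H1 Ω) : toL2 (v - w) = toL2 v - toL2 w := rfl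

lemma weakGrad_sub {N : ℕ} {Ω : Set (Space N)} (v w : H1 Ω) :
    weakGrad (v - w) = weakGrad v - weakGrad w := rfl

lemma H1.ext {N : ℕ} {Ω : Set (Space N)} {v w : H1 Ω} (h1 : toL2 v = toL2 w)
    (h2 : weakGrad v = weakGrad w) : v = w :=
  Subtype.ext (WithLp.ofLp_injective 2 (Prod.ext h1 h2))

/-- The weak derivative is unique. -/
lemma IsWeakDeriv.ae_eq {T : ℝ} {m m₁ m₂ : ℝ → ℝ} (h₁ : IsWeakDeriv T m m₁)
    (h₂ : IsWeakDeriv T m m₂) : ∀ᵐ t ∂(timeMeasure T), m₁ t = m₂ t := by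
  have hint : ∀ {f : ℝ → ℝ}, LocallyIntegrableOn f (Ioo 0 T) → ∀ ψ : ℝ → ℝ,
      IsTestFunction (Ioo 0 T) ψ → IntegrableOn (fun t => f t * ψ t) (Ioo 0 T) := by
    intro f hf ψ hψ
    have h1 : IntegrableOn (fun t => f t * ψ t) (tsupport ψ) :=
      (hf.integrableOn_compact_subset hψ.tsupport_subset hψ.hasCompactSupport).mul_continuousOn
        hψ.continuous.continuousOn hψ.hasCompactSupport
    have h2 : Integrable (fun t => f t * ψ t) :=
      (integrableOn_iff_integrable_of_support_subset fun t ht => subset_tsupport ψ fun h0 =>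
        ht (by simp [h0])).1 h1
    exact h2.integrableOn
  have := isOpen_Ioo.ae_eq_zero_of_integral_contDiff_smul_eq_zero (μ := volume)
    (h₁.1.sub h₂.1) fun ψ a1 a2 a3 => by
      have hψ : IsTestFunction (Ioo 0 T) ψ := ⟨a1, a2, a3⟩
      rw [← setIntegral_eq_integral_of_forall_compl_eq_zero (s := Ioo 0 T) fun t ht => by
        rw [hψ.eq_zero_of_notMem ht, zero_smul]]
      have e : ∀ t, ψ t • (m₁ - m₂) t = m₁ t * ψ t - m₂ t * ψ t := fun t => by
        simp only [Pi.sub_apply, smul_eq_mul]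
        ring
      simp only [e]
      rw [integral_sub (hint h₁.1 ψ hψ) (hint h₂.1 ψ hψ)]
      linarith [h₁.2 ψ hψ, h₂.2 ψ hψ]
  rw [ae_restrict_iff' measurableSet_Ioo]
  filter_upwards [this] with t ht hmem
  exact sub_eq_zero.1 (ht hmem)

/-! ### Estimates for the nonlinearity -/

section Nonlinearity

variable {N : ℕ} {Ω : Set (Space N)}

/-- Nothing is known about `f` off `Ω`, so continuity, and with it measurability, is obtained on the
subtype. -/
lemma aestronglyMeasurable_comp_of_lipschitz (hΩ : MeasurableSet Ω) {L : ℝ}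
    {f : Space N → ℝ → Space N → ℝ}
    (hL : ∀ x ∈ Ω, ∀ y ∈ Ω, ∀ (a b : ℝ) (p q : Space N),
      |f x a p - f y b q| ≤ L * (‖x - y‖ + |a - b| + ‖p - q‖))
    {v : Space N → ℝ} {G : Space N → Space N} (hv : Measurable v) (hG : Measurable G) :
    AEStronglyMeasurable (fun x => f x (v x) (G x)) (volume.restrict Ω) := by
  have hcont : Continuous (fun z : Ω × ℝ × Space N => f z.1 z.2.1 z.2.2) := by
    rw [continuous_iff_continuousAt]
    intro z
    rw [ContinuousAt, tendsto_iff_dist_tendsto_zero]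
    have hc : Continuous (fun z' : Ω × ℝ × Space N =>
        L * (‖(z'.1 : Space N) - z.1‖ + |z'.2.1 - z.2.1| + ‖z'.2.2 - z.2.2‖)) := by
      fun_prop
    have hlim := hc.tendsto z
    rw [sub_self, sub_self, sub_self, norm_zero, abs_zero, add_zero, add_zero,
      mul_zero] at hlim
    exact squeeze_zero (fun _ => dist_nonneg) (fun z' => hL _ z'.1.2 _ z.1.2 _ _ _ _) hlim
  refine (aemeasurable_restrict_of_measurable_subtype hΩ ?_).aestronglyMeasurable
  exact hcont.measurable.comp (measurable_id.prodMk
    ((hv.comp measurable_subtype_coe).prodMk (hG.comp measurable_subtype_coe)))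

/-- Comparison with `f x₀ t 0 0` gives linear growth in `v` and `G`; the remaining constants are
square integrable because `Ω` is bounded. -/
lemma memLp_comp_of_lipschitz (hΩ : IsLipschitzDomain Ω) {T L : ℝ}
    {f : Space N → ℝ → ℝ → Space N → ℝ}
    (hL : ∀ x ∈ Ω, ∀ y ∈ Ω, ∀ t ∈ Icc 0 T, ∀ s ∈ Icc 0 T, ∀ (a b : ℝ) (p q : Space N),
      |f x t a p - f y s b q| ≤ L * (‖x - y‖ + |t - s| + |a - b| + ‖p - q‖))
    {t : ℝ} (ht : t ∈ Icc 0 T) (v : L2 Ω) (G : L2Vec Ω) :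
    MemLp (fun x => f x t (v x) (G x)) 2 (volume.restrict Ω) := by
  have hΩm : MeasurableSet Ω := hΩ.isOpen.measurableSet
  have : IsFiniteMeasure (volume.restrict Ω) :=
    isFiniteMeasure_restrict.2 hΩ.isBounded.measure_lt_top.ne
  obtain ⟨x₀, hx₀⟩ := hΩ.isConnected.nonempty
  have hLt : ∀ x ∈ Ω, ∀ y ∈ Ω, ∀ (a b : ℝ) (p q : Space N),
      |f x t a p - f y t b q| ≤ L * (‖x - y‖ + |a - b| + ‖p - q‖) := by
    intro x hx y hy a b p q
    have := hL x hx y hy t ht t ht a b p q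
    rwa [sub_self, abs_zero, add_zero] at this
  have hmeas : AEStronglyMeasurable (fun x => f x t (v x) (G x)) (volume.restrict Ω) :=
    aestronglyMeasurable_comp_of_lipschitz (f := fun x a p => f x t a p) hΩm hLt
      (Lp.stronglyMeasurable v).measurable (Lp.stronglyMeasurable G).measurable
  obtain ⟨R, hR⟩ := hΩ.isBounded.subset_closedBall x₀
  have hg : MemLp (fun x => |f x₀ t 0 0| + |L| * (R + ‖v x‖ + ‖G x‖)) 2 (volume.restrict Ω) := by
    have h1 : MemLp (fun x => ‖v x‖) 2 (volume.restrict Ω) := (Lp.memLp v).norm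
    have h2 : MemLp (fun x => ‖G x‖) 2 (volume.restrict Ω) := (Lp.memLp G).norm
    have h3 : MemLp (fun _ : Space N => R) 2 (volume.restrict Ω) := memLp_const R
    have h4 : MemLp (fun _ : Space N => |f x₀ t 0 0|) 2 (volume.restrict Ω) := memLp_const _
    have h5 : MemLp (fun x => R + ‖v x‖ + ‖G x‖) 2 (volume.restrict Ω) := (h3.add h1).add h2
    have h6 : MemLp (fun x => |L| * (R + ‖v x‖ + ‖G x‖)) 2 (volume.restrict Ω) := h5.const_mul _
    exact h4.add h6
  refine hg.mono hmeas ?_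
  filter_upwards [ae_restrict_mem hΩm] with x hx
  have h1 := hLt x hx x₀ hx₀ (v x) 0 (G x) 0
  rw [sub_zero, sub_zero] at h1
  have h2 : ‖x - x₀‖ ≤ R := by simpa [dist_eq_norm] using hR hx
  have h3 : L * (‖x - x₀‖ + |v x| + ‖G x‖) ≤ |L| * (R + ‖v x‖ + ‖G x‖) := by
    rw [Real.norm_eq_abs]
    gcongr
    exact le_abs_self L
  have h4 := abs_sub_abs_le_abs_sub (f x t (v x) (G x)) (f x₀ t 0 0)
  rw [Real.norm_eq_abs]
  refine le_trans ?_ (Real.le_norm_self _)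
  linarith

lemma abs_integral_comp_sub_le (hΩ : IsLipschitzDomain Ω) {T L : ℝ}
    {f : Space N → ℝ → ℝ → Space N → ℝ}
    (hL : ∀ x ∈ Ω, ∀ y ∈ Ω, ∀ t ∈ Icc 0 T, ∀ s ∈ Icc 0 T, ∀ (a b : ℝ) (p q : Space N),
      |f x t a p - f y s b q| ≤ L * (‖x - y‖ + |t - s| + |a - b| + ‖p - q‖))
    {t : ℝ} (ht : t ∈ Icc 0 T) (v₁ v₂ : L2 Ω) (G₁ G₂ : L2Vec Ω) (φ : L2 Ω) :
    |(∫ x in Ω, f x t (v₁ x) (G₁ x) * φ x) - ∫ x in Ω, f x t (v₂ x) (G₂ x) * φ x|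
      ≤ |L| * ‖φ‖ * (‖v₁ - v₂‖ + ‖G₁ - G₂‖) := by
  have hΩm : MeasurableSet Ω := hΩ.isOpen.measurableSet
  have i1 : Integrable (fun x => f x t (v₁ x) (G₁ x) * φ x) (volume.restrict Ω) :=
    (memLp_comp_of_lipschitz hΩ hL ht v₁ G₁).integrable_mul (Lp.memLp φ)
  have i2 : Integrable (fun x => f x t (v₂ x) (G₂ x) * φ x) (volume.restrict Ω) :=
    (memLp_comp_of_lipschitz hΩ hL ht v₂ G₂).integrable_mul (Lp.memLp φ)
  have j1 : Integrable (fun x => ‖(v₁ - v₂) x‖ * ‖φ x‖) (volume.restrict Ω) :=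
    (Lp.memLp (v₁ - v₂)).norm.integrable_mul (Lp.memLp φ).norm
  have j2 : Integrable (fun x => ‖(G₁ - G₂) x‖ * ‖φ x‖) (volume.restrict Ω) :=
    (Lp.memLp (G₁ - G₂)).norm.integrable_mul (Lp.memLp φ).norm
  have c1 := integral_norm_mul_norm_le (Lp.memLp (v₁ - v₂)) (Lp.memLp φ)
  have c2 := integral_norm_mul_norm_le (Lp.memLp (G₁ - G₂)) (Lp.memLp φ)
  rw [← norm_eq_sqrt_integral, ← norm_eq_sqrt_integral] at c1 c2
  rw [← integral_sub i1 i2]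
  calc |∫ x in Ω, (f x t (v₁ x) (G₁ x) * φ x - f x t (v₂ x) (G₂ x) * φ x)|
      ≤ ∫ x in Ω, |f x t (v₁ x) (G₁ x) * φ x - f x t (v₂ x) (G₂ x) * φ x| :=
        abs_integral_le_integral_abs
    _ ≤ ∫ x in Ω, |L| * (‖(v₁ - v₂) x‖ * ‖φ x‖ + ‖(G₁ - G₂) x‖ * ‖φ x‖) := by
        refine integral_mono_ae (i1.sub i2).abs ((j1.add j2).const_mul _) ?_
        filter_upwards [ae_restrict_mem hΩm, Lp.coeFn_sub v₁ v₂, Lp.coeFn_sub G₁ G₂]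
          with x hx e1 e2
        have h1 := hL x hx x hx t ht t ht (v₁ x) (v₂ x) (G₁ x) (G₂ x)
        rw [sub_self, sub_self, norm_zero, abs_zero, zero_add, zero_add] at h1
        have h2 : L * (|v₁ x - v₂ x| + ‖G₁ x - G₂ x‖) ≤ |L| * (|v₁ x - v₂ x| + ‖G₁ x - G₂ x‖) := by
          gcongr
          exact le_abs_self L
        rw [e1, e2, Pi.sub_apply, Pi.sub_apply, ← sub_mul, abs_mul, ← add_mul, ← mul_assoc,
          Real.norm_eq_abs, Real.norm_eq_abs]
        gcongr
        exact h1.trans h2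
    _ ≤ |L| * ‖φ‖ * (‖v₁ - v₂‖ + ‖G₁ - G₂‖) := by
        rw [integral_const_mul, integral_add j1 j2, mul_assoc]
        gcongr
        linarith

/-- Testing with the constant `1`, which is in `L²(Ω)` because `Ω` is bounded. -/
lemma abs_integral_comp_sub_le_one (hΩ : IsLipschitzDomain Ω) {T L : ℝ}
    {f : Space N → ℝ → ℝ → Space N → ℝ}
    (hL : ∀ x ∈ Ω, ∀ y ∈ Ω, ∀ t ∈ Icc 0 T, ∀ s ∈ Icc 0 T, ∀ (a b : ℝ) (p q : Space N),
      |f x t a p - f y s b q| ≤ L * (‖x - y‖ + |t - s| + |a - b| + ‖p - q‖)) :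
    ∃ C : ℝ, ∀ t ∈ Icc 0 T, ∀ (v₁ v₂ : L2 Ω) (G₁ G₂ : L2Vec Ω),
      |(∫ x in Ω, f x t (v₁ x) (G₁ x)) - ∫ x in Ω, f x t (v₂ x) (G₂ x)|
        ≤ C * (‖v₁ - v₂‖ + ‖G₁ - G₂‖) := by
  have : IsFiniteMeasure (volume.restrict Ω) :=
    isFiniteMeasure_restrict.2 hΩ.isBounded.measure_lt_top.ne
  have h1 : MemLp (fun _ : Space N => (1 : ℝ)) 2 (volume.restrict Ω) := memLp_const 1
  let one : L2 Ω := h1.toLp _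
  refine ⟨|L| * ‖one‖, fun t ht v₁ v₂ G₁ G₂ => ?_⟩
  have h := abs_integral_comp_sub_le hΩ hL ht v₁ v₂ G₁ G₂ one
  have e : ∀ (v : L2 Ω) (G : L2Vec Ω), ∫ x in Ω, f x t (v x) (G x) * one x
      = ∫ x in Ω, f x t (v x) (G x) := fun v G => by
    apply integral_congr_ae
    filter_upwards [h1.coeFn_toLp] with x hx
    rw [hx, mul_one]
  rwa [e, e] at h

end Nonlinearity

/-! ### Estimates for the difference of two solutions -/

variable {N : ℕ} {Ω : Set (Space N)} {T : ℝ}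

lemma memLp_apply_L2Time {V : Type*} [NormedAddCommGroup V] [NormedSpace ℝ V]
    (p : L2Time T (StrongDual ℝ V)) (φ : V) : MemLp (fun t => p t φ) 2 (timeMeasure T) :=
  (ContinuousLinearMap.apply ℝ ℝ φ).comp_memLp' (Lp.memLp p)

lemma integrable_apply_L2Time {V : Type*} [NormedAddCommGroup V] [NormedSpace ℝ V]
    (p : L2Time T (StrongDual ℝ V)) (u : L2Time T V) :
    Integrable (fun t => p t (u t)) (timeMeasure T) :=
  memLp_one_iff_integrable.1 ((ContinuousLinearMap.id ℝ (StrongDual ℝ V)).memLp_of_bilin 1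
    (Lp.memLp p) (Lp.memLp u))

/-- The difference of two variational equations, tested with the difference of the solutions. -/
lemma sub_le_of_variational_equations {H G : Type*} [NormedAddCommGroup H] [InnerProductSpace ℝ H]
    [NormedAddCommGroup G] [InnerProductSpace ℝ G] {x₁ x₂ s k₁ k₂ F₁ F₂ L M δ₁ δ₂ : ℝ}
    {a h c₁ c₂ d₁ d₂ : H} {g₁ g₂ : G}
    (e₁ : x₁ + ⟪g₁, g₁ - g₂⟫_ℝ + s + k₁ * ⟪h, a⟫_ℝ + ⟪c₁, a⟫_ℝ = F₁)
    (e₂ : x₂ + ⟪g₂, g₁ - g₂⟫_ℝ + s + k₂ * ⟪h, a⟫_ℝ + ⟪c₂, a⟫_ℝ = F₂)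
    (hc : c₁ - c₂ = d₁ + d₂) (hd₁ : ‖d₁‖ ≤ δ₁) (hd₂ : ‖d₂‖ ≤ δ₂) (hh : ‖h‖ ≤ M)
    (hF : |F₁ - F₂| ≤ L * ‖a‖ * (‖a‖ + ‖g₁ - g₂‖)) :
    x₁ - x₂ ≤ -‖g₁ - g₂‖ ^ 2 + M * |k₁ - k₂| * ‖a‖ + δ₁ * ‖a‖ + δ₂ * ‖a‖
      + L * (‖a‖ + ‖g₁ - g₂‖) * ‖a‖ := by
  have hg : ⟪g₁, g₁ - g₂⟫_ℝ - ⟪g₂, g₁ - g₂⟫_ℝ = ‖g₁ - g₂‖ ^ 2 := by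
    rw [← inner_sub_left, real_inner_self_eq_norm_sq]
  have hca : ⟪c₁, a⟫_ℝ - ⟪c₂, a⟫_ℝ = ⟪d₁, a⟫_ℝ + ⟪d₂, a⟫_ℝ := by
    rw [← inner_sub_left, hc, inner_add_left]
  have t1 : -((k₁ - k₂) * ⟪h, a⟫_ℝ) ≤ M * |k₁ - k₂| * ‖a‖ := by
    refine (neg_le_abs _).trans ?_
    rw [abs_mul, mul_comm M, mul_assoc]
    gcongr
    exact (abs_real_inner_le_norm _ _).trans (by gcongr)
  have hinner : ∀ {d : H} {δ : ℝ}, ‖d‖ ≤ δ → -⟪d, a⟫_ℝ ≤ δ * ‖a‖ := fun hd =>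
    (neg_le_abs _).trans ((abs_real_inner_le_norm _ _).trans (by gcongr))
  have t2 := hinner hd₁
  have t3 := hinner hd₂
  have t4 := (le_abs_self _).trans hF
  have t5 : L * ‖a‖ * (‖a‖ + ‖g₁ - g₂‖) = L * (‖a‖ + ‖g₁ - g₂‖) * ‖a‖ := by ring
  linarith

set_option maxHeartbeats 1000000 in
lemma IsWeakTimeDeriv.sub {u₁ u₂ : L2Time T (H1 Ω)} {p₁ p₂ : L2Time T (StrongDual ℝ (H1 Ω))}
    (h₁ : IsWeakTimeDeriv u₁ p₁) (h₂ : IsWeakTimeDeriv u₂ p₂) :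
    IsWeakTimeDeriv (u₁ - u₂) (p₁ - p₂) := by
  intro φ ψ hψ
  have hψ2 : MemLp ψ 2 (timeMeasure T) :=
    (hψ.continuous.memLp_of_hasCompactSupport hψ.hasCompactSupport).restrict _
  have hψ'2 : MemLp (deriv ψ) 2 (timeMeasure T) :=
    ((hψ.contDiff.continuous_deriv (by simp)).memLp_of_hasCompactSupport
      hψ.hasCompactSupport.deriv).restrict _
  have hu : ∀ u : L2Time T (H1 Ω),
      Integrable (fun t => deriv ψ t * ⟪toL2 (u t), toL2 φ⟫_ℝ) (timeMeasure T) := fun u =>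
    hψ'2.integrable_mul (((innerSLFlip ℝ (toL2 φ)).comp (toL2L Ω)).comp_memLp' (Lp.memLp u))
  have hp : ∀ p : L2Time T (StrongDual ℝ (H1 Ω)),
      Integrable (fun t => ψ t * p t φ) (timeMeasure T) := fun p =>
    hψ2.integrable_mul (memLp_apply_L2Time p φ)
  have e1 : ∫ t in Ioo 0 T, deriv ψ t * ⟪toL2 ((u₁ - u₂) t), toL2 φ⟫_ℝ
      = ∫ t in Ioo 0 T, (deriv ψ t * ⟪toL2 (u₁ t), toL2 φ⟫_ℝ
        - deriv ψ t * ⟪toL2 (u₂ t), toL2 φ⟫_ℝ) := by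
    apply integral_congr_ae
    filter_upwards [Lp.coeFn_sub u₁ u₂] with t ht
    rw [ht, Pi.sub_apply, toL2_sub, inner_sub_left, mul_sub]
  have e2 : ∫ t in Ioo 0 T, ψ t * (p₁ - p₂) t φ
      = ∫ t in Ioo 0 T, (ψ t * p₁ t φ - ψ t * p₂ t φ) := by
    apply integral_congr_ae
    filter_upwards [Lp.coeFn_sub p₁ p₂] with t ht
    rw [ht, Pi.sub_apply, sub_apply, mul_sub]
  rw [e1, e2, integral_sub (hu u₁) (hu u₂), integral_sub (hp p₁) (hp p₂), h₁ φ ψ hψ, h₂ φ ψ hψ]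
  ring

lemma memLp_toL2 (u : L2Time T (H1 Ω)) : MemLp (fun t => toL2 (u t)) 2 (timeMeasure T) :=
  (toL2L Ω).comp_memLp' (Lp.memLp u)

lemma memLp_weakGrad (u : L2Time T (H1 Ω)) : MemLp (fun t => weakGrad (u t)) 2 (timeMeasure T) :=
  (weakGradL Ω).comp_memLp' (Lp.memLp u)

lemma intervalIntegrable_norm_sq {X : Type*} [NormedAddCommGroup X] (hT : 0 ≤ T) {v : ℝ → X}
    (hv : MemLp v 2 (timeMeasure T)) : IntervalIntegrable (fun t => ‖v t‖ ^ 2) volume 0 T :=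
  (intervalIntegrable_iff_integrableOn_Ioo_of_le hT).2 hv.norm.integrable_sq

lemma integral_norm_sq_le {X : Type*} [NormedAddCommGroup X] {v : ℝ → X}
    (hv : MemLp v 2 (timeMeasure T)) {t : ℝ} (ht : t ∈ Icc 0 T) :
    ∫ s in (0 : ℝ)..t, ‖v s‖ ^ 2 ≤ ∫ s in (0 : ℝ)..T, ‖v s‖ ^ 2 :=
  intervalIntegral.integral_mono_interval le_rfl ht.1 ht.2
    (Eventually.of_forall fun _ => sq_nonneg _)
    (intervalIntegrable_norm_sq (ht.1.trans ht.2) hv)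

/-- Flux and `m'` cancel, and both kernels are convolved with the same `m`, so only `(K₁ - K₂) ∗ m`
and the nonlinearity remain. -/
lemma SolvesMP.mul_abs_sub_le {D : ProblemData Ω} {m₁ m₂ : ℝ → ℝ} {u₁ u₂ : L2Time T (H1 Ω)}
    {K₁ K₂ : L2Time T ℝ} {t c C : ℝ} (ht : t ∈ Icc 0 T) (hh : c ≤ |∫ x in Ω, D.h t x|)
    (hm : MemLp D.m 2 (timeMeasure T))
    (hf : |(∫ x in Ω, D.f x t (toL2 (u₁ t) x) (weakGrad (u₁ t) x))
        - ∫ x in Ω, D.f x t (toL2 (u₂ t) x) (weakGrad (u₂ t) x)|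
      ≤ C * (‖toL2 (u₁ t) - toL2 (u₂ t)‖ + ‖weakGrad (u₁ t) - weakGrad (u₂ t)‖))
    (hmm : m₁ t = m₂ t) (h₁ : SolvesMP D m₁ u₁ K₁ t) (h₂ : SolvesMP D m₂ u₂ K₂ t) :
    c * |K₁ t - K₂ t| ≤ √(∫ s in (0 : ℝ)..T, ‖D.m s‖ ^ 2)
        * √(∫ s in (0 : ℝ)..t, |K₁ s - K₂ s| ^ 2)
      + C * (‖toL2 (u₁ t) - toL2 (u₂ t)‖ + ‖weakGrad (u₁ t) - weakGrad (u₂ t)‖) := by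
  have hconv := timeConv_sub_timeConv ht (Lp.memLp K₁) (Lp.memLp K₂) hm hm
  have hz : timeConv (⇑K₂) (D.m - D.m) t = 0 := by simp [timeConv]
  rw [hz, add_zero] at hconv
  have hbound := norm_timeConv_le ht ((Lp.memLp K₁).sub (Lp.memLp K₂)) hm
  have hmono := Real.sqrt_le_sqrt (integral_norm_sq_le hm ht)
  simp only [SolvesMP] at h₁ h₂
  have hid : (K₁ t - K₂ t) * (∫ x in Ω, D.h t x)
      = ((∫ x in Ω, D.f x t (toL2 (u₁ t) x) (weakGrad (u₁ t) x))
        - ∫ x in Ω, D.f x t (toL2 (u₂ t) x) (weakGrad (u₂ t) x))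
        - timeConv (⇑K₁ - ⇑K₂) D.m t := by
    rw [← hconv, sub_mul]
    linarith
  calc c * |K₁ t - K₂ t| ≤ |∫ x in Ω, D.h t x| * |K₁ t - K₂ t| := by gcongr
    _ = |(K₁ t - K₂ t) * (∫ x in Ω, D.h t x)| := by rw [abs_mul, mul_comm]
    _ ≤ _ := by
      rw [hid]
      refine (abs_sub _ _).trans ?_
      rw [add_comm]
      refine add_le_add (hbound.trans ?_) hf
      rw [mul_comm]
      simp only [Pi.sub_apply, sq_abs]
      gcongr

-- At fixed `t` the value `u₁ t - u₂ t` is an admissible test function. The boundary term is the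
-- same in both equations, so it cancels without any property of the trace.
set_option maxHeartbeats 1000000 in
lemma SolvesP.apply_sub_le {D : ProblemData Ω} {p₁ p₂ : L2Time T (StrongDual ℝ (H1 Ω))}
    {u₁ u₂ : L2Time T (H1 Ω)} {K₁ K₂ : L2Time T ℝ} {t L M : ℝ} (ht : t ∈ Icc 0 T)
    (hh : ‖D.h t‖ ≤ M)
    (hf : ∀ φ : L2 Ω, |(∫ x in Ω, D.f x t (toL2 (u₁ t) x) (weakGrad (u₁ t) x) * φ x)
        - ∫ x in Ω, D.f x t (toL2 (u₂ t) x) (weakGrad (u₂ t) x) * φ x|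
      ≤ L * ‖φ‖ * (‖toL2 (u₁ t) - toL2 (u₂ t)‖ + ‖weakGrad (u₁ t) - weakGrad (u₂ t)‖))
    (h₁ : SolvesP D u₁ p₁ K₁ t) (h₂ : SolvesP D u₂ p₂ K₂ t) :
    p₁ t (u₁ t - u₂ t) - p₂ t (u₁ t - u₂ t) ≤ -‖weakGrad (u₁ t) - weakGrad (u₂ t)‖ ^ 2
      + M * |K₁ t - K₂ t| * ‖toL2 (u₁ t) - toL2 (u₂ t)‖
      + √(∫ s in (0 : ℝ)..T, ‖toL2 (u₁ s)‖ ^ 2) * √(∫ s in (0 : ℝ)..t, |K₁ s - K₂ s| ^ 2)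
        * ‖toL2 (u₁ t) - toL2 (u₂ t)‖
      + √(∫ s in (0 : ℝ)..T, ‖K₂ s‖ ^ 2)
        * √(∫ s in (0 : ℝ)..t, ‖toL2 (u₁ s) - toL2 (u₂ s)‖ ^ 2) * ‖toL2 (u₁ t) - toL2 (u₂ t)‖
      + L * (‖toL2 (u₁ t) - toL2 (u₂ t)‖ + ‖weakGrad (u₁ t) - weakGrad (u₂ t)‖)
        * ‖toL2 (u₁ t) - toL2 (u₂ t)‖ := by
  have hconv := timeConv_sub_timeConv ht (Lp.memLp K₁) (Lp.memLp K₂) (memLp_toL2 u₁)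
    (memLp_toL2 u₂)
  have hb1 := norm_timeConv_le ht ((Lp.memLp K₁).sub (Lp.memLp K₂)) (memLp_toL2 u₁)
  have hb2 := norm_timeConv_le ht (Lp.memLp K₂) ((memLp_toL2 u₁).sub (memLp_toL2 u₂))
  have hm1 := Real.sqrt_le_sqrt (integral_norm_sq_le (memLp_toL2 u₁) ht)
  have hm2 := Real.sqrt_le_sqrt (integral_norm_sq_le (Lp.memLp K₂) ht)
  have e₁ := h₁ (u₁ t - u₂ t)
  have e₂ := h₂ (u₁ t - u₂ t)
  rw [toL2_sub, weakGrad_sub] at e₁ e₂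
  refine sub_le_of_variational_equations e₁ e₂ hconv (hb1.trans ?_) (hb2.trans ?_) hh (hf _)
  · rw [mul_comm]
    simp only [Pi.sub_apply, sq_abs]
    gcongr
  · simp only [Pi.sub_apply, Real.norm_eq_abs, sq_abs] at hm2 ⊢
    gcongr

/-! ### Uniqueness -/

set_option maxHeartbeats 1000000 in
/-- Uniqueness of the pair consisting of the solution and the memory kernel. -/
theorem IsSolution.unique (hΩ : IsLipschitzDomain Ω) (hT : 0 < T) {D : ProblemData Ω}
    (hh : ContinuousOn D.h (Icc 0 T)) {c : ℝ} (hc : 0 < c)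
    (hh1 : ∀ t ∈ Icc 0 T, c ≤ |∫ x in Ω, D.h t x|) (hm : ContinuousOn D.m (Icc 0 T))
    (hf : IsLipschitzInAllVariables Ω T D.f) {u₁ u₂ : L2Time T (H1 Ω)} {K₁ K₂ : L2Time T ℝ}
    (h₁ : IsSolution D u₁ K₁) (h₂ : IsSolution D u₂ K₂) : u₁ = u₂ ∧ K₁ = K₂ := by
  obtain ⟨⟨w₁, hw₁, hwu₁, hw₁0⟩, ⟨p₁, hp₁, hP₁⟩, m₁, hm₁, hMP₁⟩ := h₁
  obtain ⟨⟨w₂, hw₂, hwu₂, hw₂0⟩, ⟨p₂, hp₂, hP₂⟩, m₂, hm₂, hMP₂⟩ := h₂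
  obtain ⟨L, hL⟩ := hf
  obtain ⟨C, hC⟩ := abs_integral_comp_sub_le_one hΩ hL
  obtain ⟨M, hM⟩ := isCompact_Icc.exists_bound_of_continuousOn hh
  obtain ⟨R, hR⟩ := isCompact_Icc.exists_bound_of_continuousOn hm
  have hm2 : MemLp D.m 2 (timeMeasure T) := by
    refine MemLp.of_bound
      ((hm.mono Ioo_subset_Icc_self).aestronglyMeasurable measurableSet_Ioo) R ?_
    filter_upwards [ae_restrict_mem measurableSet_Ioo] with t ht
    exact hR t (Ioo_subset_Icc_self ht)
  have hu := Lp.coeFn_sub u₁ u₂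
  have hp := Lp.coeFn_sub p₁ p₂
  have hwu : ∀ᵐ t ∂(timeMeasure T), (w₁ - w₂) t = toL2L Ω ((u₁ - u₂ : L2Time T (H1 Ω)) t) := by
    filter_upwards [hwu₁, hwu₂, hu] with t a1 a2 a3
    rw [a3, Pi.sub_apply, Pi.sub_apply, a1, a2, toL2L_apply, toL2_sub]
  have hw0 : (w₁ - w₂) 0 = 0 := by rw [Pi.sub_apply, hw₁0, hw₂0, sub_self]
  have henergy := norm_sq_eq_of_weakDeriv (toL2L Ω) hT (u₁ - u₂) (p₁ - p₂) (hw₁.sub hw₂) hwu hw0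
    (hp₁.sub hp₂)
  have he : Integrable (fun t => (p₁ - p₂ : L2Time T (StrongDual ℝ (H1 Ω))) t
      ((u₁ - u₂ : L2Time T (H1 Ω)) t)) (timeMeasure T) :=
    integrable_apply_L2Time _ _
  -- The memory coefficients are the norms over `(0,T)` of `u₁`, `K₂` and `m`, finite for the given
  -- solutions. `y` uses the continuous representatives, whose difference starts at `0`.
  have hzero := ae_eq_zero_of_energy_inequality (c := c) hT hc
    √(∫ s in (0 : ℝ)..T, ‖toL2 (u₁ s)‖ ^ 2) √(∫ s in (0 : ℝ)..T, ‖K₂ s‖ ^ 2) M |L|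
    √(∫ s in (0 : ℝ)..T, ‖D.m s‖ ^ 2) C
    (α := fun t => ‖toL2 (u₁ t) - toL2 (u₂ t)‖)
    (β := fun t => ‖weakGrad (u₁ t) - weakGrad (u₂ t)‖)
    (k := fun t => |K₁ t - K₂ t|) (y := fun t => ‖(w₁ - w₂) t‖ ^ 2)
    (fun _ => abs_nonneg _)
    (intervalIntegrable_norm_sq hT.le ((memLp_toL2 u₁).sub (memLp_toL2 u₂)))
    (intervalIntegrable_norm_sq hT.le ((memLp_weakGrad u₁).sub (memLp_weakGrad u₂)))
    (intervalIntegrable_norm_sq hT.le ((Lp.memLp K₁).sub (Lp.memLp K₂)))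
    ((intervalIntegrable_iff_integrableOn_Ioo_of_le hT.le).2 he)
    ((hw₁.sub hw₂).norm.pow 2) (fun _ => sq_nonneg _)
    (by
      filter_upwards [hwu₁, hwu₂] with t a1 a2
      rw [Pi.sub_apply, a1, a2])
    henergy
    (by
      filter_upwards [hMP₁, hMP₂, hm₁.ae_eq hm₂, ae_restrict_mem measurableSet_Ioo]
        with t a1 a2 a3 ht
      have ht' := Ioo_subset_Icc_self ht
      exact a1.mul_abs_sub_le ht' (hh1 t ht') hm2 (hC t ht' _ _ _ _) a3 a2)
    (by
      filter_upwards [hP₁, hP₂, hu, hp, ae_restrict_mem measurableSet_Ioo] with t a1 a2 a3 a4 ht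
      have ht' := Ioo_subset_Icc_self ht
      rw [a3, a4, Pi.sub_apply, Pi.sub_apply, sub_apply]
      exact a1.apply_sub_le ht' (hM t ht')
        (fun φ => abs_integral_comp_sub_le hΩ hL ht' _ _ _ _ φ) a2)
  constructor
  · refine Lp.ext ?_
    filter_upwards [hzero] with t ht
    exact H1.ext (sub_eq_zero.1 (norm_eq_zero.1 ht.1)) (sub_eq_zero.1 (norm_eq_zero.1 ht.2.1))
  · refine Lp.ext ?_
    filter_upwards [hzero] with t ht
    exact sub_eq_zero.1 (abs_eq_zero.1 ht.2.2)

end KernelReconstruction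

end

theorem theorem2p1 {N : ℕ} (hN : 1 ≤ N) {Ω : Set (KernelReconstruction.Space N)}
    (hΩ : KernelReconstruction.IsLipschitzDomain Ω) {T : ℝ} (hT : 0 < T)
    (D : KernelReconstruction.ProblemData Ω)
    (hh : ContinuousOn D.h (Set.Icc 0 T))
    {c : ℝ} (hc : 0 < c)
    (hh1 : ∀ t ∈ Set.Icc 0 T, c ≤ |∫ x in Ω, D.h t x|)
    (hm : ContinuousOn D.m (Set.Icc 0 T))
    (hf : KernelReconstruction.IsLipschitzInAllVariables Ω T D.f)
    (u₁ u₂ : KernelReconstruction.L2Time T (KernelReconstruction.H1 Ω))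
    (K₁ K₂ : KernelReconstruction.L2Time T ℝ)
    (h₁ : KernelReconstruction.IsSolution D u₁ K₁)
    (h₂ : KernelReconstruction.IsSolution D u₂ K₂) :
    u₁ = u₂ ∧ K₁ = K₂ :=
  KernelReconstruction.IsSolution.unique hΩ hT hh hc hh1 hm hf h₁ h₂
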